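/- Let $u$ be the Hastings--McLeod solution of Painlev\'e II, i.e. the real solution on $\mathbb{R}$ of $u''=tu+2u^3$ with $u(t)\to 0$ as $t\to\infty$ and $u(t)\sim\sqrt{-t/2}$ as $t\to-\infty$. Consider the system $$q_2'=\tfrac23\alpha q_2+\frac{u'}{u}\,\frac{(1+q_2)(2-q_2)}{3},\qquad \alpha'=\alpha\Big(\tfrac23\alpha+\frac{u'}{u}\,\frac{2-q_2}{3}\Big)-\frac t6(1+q_2)-\frac{u^2}{3}(3+q_2).\qquad(*)$$ Say that a pair of real functions $(q_2,\alpha)$ has the asymptotics (A) at $-\infty$, with real coefficient sequences $(a_n)_{n\ge0}$, $(b_n)_{n\ge0}$, if, as $t\to-\infty$, $$q_2(t)\sim\sum_{n\ge0}a_n(-t)^{-\frac32-\frac{3n}2},\qquad \alpha(t)\sim\sum_{n\ge0}b_n(-t)^{\frac12-\frac{3n}2}$$ as asymptotic series to all orders, where $$(a_0,a_1,a_2,a_3)=\Big(\tfrac1{\sqrt2},\tfrac{21}8,\tfrac{1707}{64\sqrt2},\tfrac{49123}{256}\Big),\qquad (b_0,b_1,b_2,b_3)=\Big(\tfrac1{\sqrt2},-\tfrac18,-\tfrac{37}{64\sqrt2},-\tfrac{373}{256}\Big).$$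 Theorem. Suppose that a real solution $(q_{20},\alpha_0)$ of $(*)$ is nonsingular on $(-\infty,t_0]$ and has the asymptotics (A) with coefficients $(a_n),(b_n)$. Then every nearby solution is nonsingular on $(-\infty,t_0]$ and has the same asymptotics. Precisely: for every $t_1\le t_0$ there is $\delta>0$ such that for all real $x,y$ with $|x-q_{20}(t_1)|<\delta$ and $|y-\alpha_0(t_1)|<\delta$ the solution $(q_2,\alpha)$ of $(*)$ with $q_2(t_1)=x$, $\alpha(t_1)=y$ exists on all of $(-\infty,t_0]$, is unique (every solution with these values at $t_1$ on an interval $J$ with $t_1\in J\subseteq(-\infty,t_0]$ agrees with it on $J$), and has the asymptotics (A) with the same coefficients $(a_n),(b_n)$. Moreover it is exponentially close to $(q_{20},\alpha_0)$: as $t\to-\infty$, $$q_2(t)-q_{20}(t)=O\Big((-t)^{\frac14}e^{-\frac{2\sqrt2}9(-t)^{3/2}}\Big),\qquad \alpha(t)-\alpha_0(t)=O\Big((-t)^{-\frac34}e^{-\frac{2\sqrt2}9(-t)^{3/2}}\Big).$$ -/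

import Mathlib

open Filter Topology Asymptotics

/-- The Hastings-McLeod solution `u` of Painlevé II: the real solution on the whole line of
`u'' = t u + 2 u ^ 3` with `u(t) → 0` as `t → ∞` and `u(t) ~ √(-t / 2)` as `t → -∞`. -/
structure IsHastingsMcLeod (u : ℝ → ℝ) : Prop where
  differentiable : Differentiable ℝ u
  painleve : ∀ t : ℝ, HasDerivAt (deriv u) (t * u t + 2 * u t ^ 3) t
  tendsto_atTop : Tendsto u atTop (𝓝 0)
  isEquivalent_atBot : u ~[atBot] fun t : ℝ => √(-t / 2)

/-- `(q, α)` is a (finite, real, differentiable) solution of the `q₂`-`α` system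
`q' = (2/3) α q + (u'/u) (1 + q) (2 - q) / 3`,
`α' = α ((2/3) α + (u'/u) (2 - q) / 3) - (t/6) (1 + q) - (u²/3) (3 + q)`
at every point of `S`; derivatives are taken within `S`, hence one-sided at the ends of an
interval. -/
structure IsQAlphaSolutionOn (u q α : ℝ → ℝ) (S : Set ℝ) : Prop where
  deriv_q : ∀ t ∈ S, HasDerivWithinAt q
    (2 / 3 * α t * q t + deriv u t / u t * ((1 + q t) * (2 - q t) / 3)) S t
  deriv_α : ∀ t ∈ S, HasDerivWithinAt α
    (α t * (2 / 3 * α t + deriv u t / u t * ((2 - q t) / 3)) - t / 6 * (1 + q t)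
      - u t ^ 2 / 3 * (3 + q t)) S t

/-- The asymptotic expansion `f(t) ~ ∑ n, c n * (-t) ^ (ρ - 3 n / 2)` as `t → -∞`, to all orders,
in the sense of Poincaré: every partial sum is accurate up to the size of the next term. -/
def HasExpansionAtBot (f : ℝ → ℝ) (ρ : ℝ) (c : ℕ → ℝ) : Prop :=
  ∀ N : ℕ, (fun t : ℝ => f t - ∑ n ∈ Finset.range N, c n * (-t) ^ (ρ - 3 * (n : ℝ) / 2))
    =O[atBot] fun t : ℝ => (-t) ^ (ρ - 3 * (N : ℝ) / 2)

/-- The asymptotics at `t = -∞`, with full coefficient sequences `a` and `b`: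
`q(t) = (1/√2) (-t)^(-3/2) + (21/8) (-t)^(-3) + (1707/(64√2)) (-t)^(-9/2)
  + (49123/256) (-t)^(-6) + ∑ n ≥ 4, a n (-t)^(-3/2 - 3n/2)`,
`α(t) = (1/√2) (-t)^(1/2) - (1/8) (-t)^(-1) - (37/(64√2)) (-t)^(-5/2)
  - (373/256) (-t)^(-4) + ∑ n ≥ 4, b n (-t)^(1/2 - 3n/2)`. -/
structure HasQAlphaAsymptotics (a b : ℕ → ℝ) (q α : ℝ → ℝ) : Prop where
  a_zero : a 0 = 1 / √2
  a_one : a 1 = 21 / 8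
  a_two : a 2 = 1707 / (64 * √2)
  a_three : a 3 = 49123 / 256
  b_zero : b 0 = 1 / √2
  b_one : b 1 = -(1 / 8)
  b_two : b 2 = -(37 / (64 * √2))
  b_three : b 3 = -(373 / 256)
  expansion_q : HasExpansionAtBot q (-(3 / 2)) a
  expansion_α : HasExpansionAtBot α (1 / 2) b

/-! Put `s = -t` and let `(Q, P)` be the difference between a solution and the given one. The system
is polynomial of degree two in `(q, α)`, so `(Q, P)` obeys an exact system, given by `qIncrement`
and `alphaIncrement`. Along the given solution `α ≈ √(s/2) - 1/(8s)`, `u'/u ≈ -1/(2s)`, `q` is small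
and `u² + t/2 = O(s⁻²)`. With `l = √2/3` the leading part in the variable `s` is `Q' = (1/(4s) -
l√s) Q`, `P' = -2l√s P - (l/(4√s)) Q`. Both modes decay as `t → -∞`, which is why no condition on
the initial data is needed. The slow mode has `P ≈ -Q/(4s)` and `Q` of size `s^(1/4) exp(-(2l/3)
s^(3/2))`, which is the claimed rate.

The combination `R = sP + Q/4` vanishes to leading order on the slow mode. The energy `E = Q² + R²`
therefore satisfies `E' ≤ (1/(2s) - 2l√s + O(s^(-3/2)) + O(√E/s)) E` (`energy_estimate`). A crude
form keeps `E ≤ 1` and gives `E = O(1/s)`; then all errors are integrable and the sharp rate follows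
(`increment_decay`). It lies below every power of `s`, so the expansions carry over.

Two facts about `u` are needed. The two-term asymptotics of `u'/u` and `u²` (`exists_asymptotics`)
come from `u' ± (u² + t/2)`, which satisfy first-order linear equations. The function `u` has no
zeros (`ne_zero`), so the coefficients are continuous.

For existence, the increment field is truncated, which makes it solvable on the whole half-line.
Gronwall on a compact interval and the energy bound beyond it show that the truncation is never
active. -/

/-! ### Bounds for scalar linear equations with rate at least `√s`. -/

theorem antitoneOn_Ici_of_hasDerivAt_nonpos {f f' : ℝ → ℝ} {S : ℝ}
    (h : ∀ s, S ≤ s → HasDerivAt f (f' s) s) (h0 : ∀ s, S ≤ s → f' s ≤ 0) :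
    AntitoneOn f (Set.Ici S) := by
  refine antitoneOn_of_hasDerivWithinAt_nonpos (f' := f') (convex_Ici S)
    (fun s hs => (h s hs).continuousAt.continuousWithinAt) ?_ ?_
  · intro s hs; rw [interior_Ici] at hs; exact (h s (le_of_lt hs)).hasDerivWithinAt
  · intro s hs; rw [interior_Ici] at hs; exact h0 s (le_of_lt hs)

theorem monotoneOn_Ici_of_hasDerivAt_nonneg {f f' : ℝ → ℝ} {S : ℝ}
    (h : ∀ s, S ≤ s → HasDerivAt f (f' s) s) (h0 : ∀ s, S ≤ s → 0 ≤ f' s) :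
    MonotoneOn f (Set.Ici S) := by
  have := antitoneOn_Ici_of_hasDerivAt_nonpos (fun s hs => (h s hs).neg)
    (fun s hs => neg_nonpos.2 (h0 s hs))
  intro x hx y hy hxy
  simpa using this hx hy hxy

/-- A function whose derivative is negative whenever it takes the value `C` stays below `C`. -/
theorem le_of_hasDerivAt_neg_of_eq {f f' : ℝ → ℝ} {S C : ℝ}
    (h : ∀ s, S ≤ s → HasDerivAt f (f' s) s) (hS : f S ≤ C)
    (hC : ∀ s, S ≤ s → f s = C → f' s < 0) : ∀ s, S ≤ s → f s ≤ C := by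
  intro s hs
  refine image_le_of_deriv_right_lt_deriv_boundary (f := f) (f' := f') (a := S) (b := s)
    (B := fun _ => C) (B' := fun _ => 0) ?_ ?_ hS (fun x => hasDerivAt_const x C) ?_ ⟨hs, le_rfl⟩
  · exact fun x hx => (h x hx.1).continuousAt.continuousWithinAt
  · exact fun x hx => (h x hx.1).hasDerivWithinAt
  · exact fun x hx hx' => hC x hx.1 hx'

theorem hasDerivAt_sq_mul_pow_succ {y : ℝ → ℝ} {y' s : ℝ} (m : ℕ) (h : HasDerivAt y y' s) :
    HasDerivAt (fun s => y s ^ 2 * s ^ (m + 1))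
      (2 * y s * y' * (s ^ m * s) + (m + 1) * y s ^ 2 * s ^ m) s := by
  have := (h.pow 2).mul (hasDerivAt_pow (m + 1) s)
  refine this.congr_deriv ?_
  simp [pow_succ]
  ring

/-- Completing the square in `√s y + 2g` absorbs the forcing, and `2(m + 1) ≤ s` absorbs the
derivative of the weight. The one inequality serves both directions: `F = y² s^(m+1)` relaxes
towards the region `F ≤ 2K²` in the stable case and is repelled from it in the unstable case. -/
theorem weighted_cross_term_le {s y g p K : ℝ} {m : ℕ} (hs : 1 ≤ s) (hsm : 2 * ((m : ℝ) + 1) ≤ s)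
    (hp : √s ≤ p) (hg : g ^ 2 * s ^ m ≤ K ^ 2) :
    √s * (y ^ 2 * s ^ (m + 1) - 2 * K ^ 2) ≤
      2 * y * (p * y + g) * (s ^ m * s) - (m + 1) * y ^ 2 * s ^ m := by
  have hσ : 1 ≤ √s := Real.one_le_sqrt.2 hs
  have hss : √s ^ 2 = s := Real.sq_sqrt (by linarith)
  have hw : 0 < s ^ m := by positivity
  have h1 : 0 ≤ (p - √s) * (y ^ 2 * (s ^ m * s)) := mul_nonneg (by linarith) (by positivity)
  have h2 : 0 ≤ √s / 2 * (√s * y + 2 * g) ^ 2 * s ^ m := by positivity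
  have h3 : 0 ≤ √s * (K ^ 2 - g ^ 2 * s ^ m) := mul_nonneg (by linarith) (by linarith)
  have h4 : (m + 1) * (y ^ 2 * s ^ m) ≤ √s * s / 2 * (y ^ 2 * s ^ m) := by
    apply mul_le_mul_of_nonneg_right _ (by positivity)
    nlinarith
  have h5 : √s / 2 * (√s * y + 2 * g) ^ 2 * s ^ m
      = √s * (y ^ 2 * (s ^ m * s)) / 2 + 2 * (g * y * (s ^ m * s)) + 2 * √s * (g ^ 2 * s ^ m) := by
    have : √s / 2 * (√s * y + 2 * g) ^ 2 * s ^ m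
      = √s * y ^ 2 * s ^ m * √s ^ 2 / 2 + 2 * (g * y * s ^ m) * √s ^ 2
        + 2 * √s * (g ^ 2 * s ^ m) := by ring
    rw [this, hss]; ring
  rw [h5] at h2
  rw [pow_succ s]
  nlinarith

/-- Solutions of `y' = -p y + g` with `p ≥ √s` and `g = O(s ^ (-m / 2))` are
`O(s ^ (-(m + 1) / 2))`. -/
theorem sq_mul_pow_bounded_of_stable {y p g : ℝ → ℝ} {K S : ℝ} (m : ℕ)
    (hSm : 2 * ((m : ℝ) + 1) ≤ S)
    (hy : ∀ s, S ≤ s → HasDerivAt y (-(p s * y s) + g s) s)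
    (hp : ∀ s, S ≤ s → √s ≤ p s) (hg : ∀ s, S ≤ s → g s ^ 2 * s ^ m ≤ K ^ 2) :
    ∃ C, ∀ s, S ≤ s → y s ^ 2 * s ^ (m + 1) ≤ C := by
  -- The `+ 1` makes the derivative strictly negative on the barrier.
  refine ⟨max (y S ^ 2 * S ^ (m + 1)) (2 * K ^ 2 + 1), ?_⟩
  refine le_of_hasDerivAt_neg_of_eq (fun s hs => hasDerivAt_sq_mul_pow_succ m (hy s hs))
    (le_max_left _ _) ?_
  intro s hs hC
  have h := weighted_cross_term_le (s := s) (y := y s) (p := p s) (g := -g s) (K := K) (m := m)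
    (by linarith) (by linarith) (hp s hs) (by simpa using hg s hs)
  have hσ : 1 ≤ √s := Real.one_le_sqrt.2 (by linarith)
  have : 1 ≤ y s ^ 2 * s ^ (m + 1) - 2 * K ^ 2 := by
    rw [hC]; linarith [le_max_right (y S ^ 2 * S ^ (m + 1)) (2 * K ^ 2 + 1)]
  nlinarith

theorem hasDerivAt_rpow_three_halves {s : ℝ} (hs : 0 < s) :
    HasDerivAt (fun s : ℝ => s ^ (3 / 2 : ℝ)) (3 / 2 * √s) s := by
  have := Real.hasDerivAt_rpow_const (x := s) (p := 3 / 2) (Or.inl hs.ne')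
  refine this.congr_deriv ?_
  rw [Real.sqrt_eq_rpow]; norm_num

theorem isLittleO_exp_neg_mul_rpow_three_halves {c : ℝ} (hc : 0 < c) (b : ℝ) :
    (fun s : ℝ => Real.exp (-c * s ^ (3 / 2 : ℝ))) =o[atTop] fun s : ℝ => s ^ b := by
  have h := (isLittleO_exp_neg_mul_rpow_atTop hc (b * (2 / 3))).comp_tendsto
    (tendsto_rpow_atTop (y := 3 / 2) (by norm_num))
  refine h.congr' (Eventually.of_forall fun s => rfl) ?_
  filter_upwards [eventually_ge_atTop 0] with s hs
  simp only [Function.comp]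
  rw [← Real.rpow_mul hs]
  congr 1; ring

/-- Solutions of `y' = p y + g` with `p ≥ √s` and `g = O(s ^ (-m / 2))` that do not grow
exponentially are `O(s ^ (-(m + 1) / 2))`. -/
theorem sq_mul_pow_bounded_of_unstable {y p g : ℝ → ℝ} {K S : ℝ} (m N : ℕ)
    (hSm : 2 * ((m : ℝ) + 1) ≤ S)
    (hy : ∀ s, S ≤ s → HasDerivAt y (p s * y s + g s) s)
    (hp : ∀ s, S ≤ s → √s ≤ p s) (hg : ∀ s, S ≤ s → g s ^ 2 * s ^ m ≤ K ^ 2)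
    (hgrow : (fun s => y s ^ 2 * s ^ (m + 1)) =O[atTop] fun s => s ^ N) :
    ∀ s, S ≤ s → y s ^ 2 * s ^ (m + 1) ≤ 2 * K ^ 2 := by
  intro s₀ hs₀
  by_contra! hlt
  set F : ℝ → ℝ := fun s => y s ^ 2 * s ^ (m + 1) with hF
  have hd : ∀ s, S ≤ s → HasDerivAt (fun s => (F s - 2 * K ^ 2) *
      Real.exp (-(2 / 3) * s ^ (3 / 2 : ℝ)))
      ((2 * y s * (p s * y s + g s) * (s ^ m * s) + (m + 1) * y s ^ 2 * s ^ m
        - √s * (F s - 2 * K ^ 2)) * Real.exp (-(2 / 3) * s ^ (3 / 2 : ℝ))) s := by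
    intro s hs
    have h1 := ((hasDerivAt_sq_mul_pow_succ m (hy s hs)).sub_const (2 * K ^ 2)).mul
      (((hasDerivAt_rpow_three_halves (s := s) (by linarith)).const_mul (-(2 / 3))).exp)
    refine h1.congr_deriv ?_
    simp only [hF]
    ring
  -- As `(2/3) s^(3/2)` is a primitive of `√s`, an excess of `F` over `2K²` would grow at least like
  -- `exp((2/3) s^(3/2))`, against polynomial growth.
  have hmono := monotoneOn_Ici_of_hasDerivAt_nonneg hd (fun s hs => by
    have h := weighted_cross_term_le (s := s) (y := y s) (p := p s) (g := g s) (K := K) (m := m)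
      (by linarith) (by linarith) (hp s hs) (hg s hs)
    have h2 : 0 ≤ (m + 1) * y s ^ 2 * s ^ m :=
      mul_nonneg (by positivity) (pow_nonneg (by linarith) _)
    apply mul_nonneg _ (Real.exp_pos _).le
    simp only [hF]
    linarith)
  have hN : (fun s : ℝ => s ^ N) =O[atTop] fun s : ℝ => s ^ (N : ℝ) := by
    refine IsBigO.of_bound 1 (Eventually.of_forall fun s => ?_)
    simp
  have hc : (fun _ : ℝ => 2 * K ^ 2) =O[atTop] fun s : ℝ => s ^ (N : ℝ) := by
    refine IsBigO.of_bound ‖2 * K ^ 2‖ ?_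
    filter_upwards [eventually_ge_atTop 1] with s hs
    rw [Real.norm_eq_abs (s ^ (N : ℝ)), Real.rpow_natCast, abs_of_nonneg (by positivity)]
    exact le_mul_of_one_le_right (norm_nonneg _) (one_le_pow₀ hs)
  have hO : (fun s => (F s - 2 * K ^ 2) * Real.exp (-(2 / 3) * s ^ (3 / 2 : ℝ)))
      =o[atTop] fun s : ℝ => s ^ (N : ℝ) * s ^ (-(N : ℝ)) :=
    ((hgrow.trans hN).sub hc).mul_isLittleO
      (isLittleO_exp_neg_mul_rpow_three_halves (by norm_num) _)
  have hlim : Tendsto (fun s => (F s - 2 * K ^ 2) * Real.exp (-(2 / 3) * s ^ (3 / 2 : ℝ)))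
      atTop (𝓝 0) := by
    rw [← isLittleO_one_iff ℝ]
    refine hO.congr' EventuallyEq.rfl ?_
    filter_upwards [eventually_gt_atTop 0] with s hs
    rw [← Real.rpow_add hs]; simp
  have hle : (F s₀ - 2 * K ^ 2) * Real.exp (-(2 / 3) * s₀ ^ (3 / 2 : ℝ)) ≤ 0 := by
    refine ge_of_tendsto hlim ?_
    filter_upwards [eventually_ge_atTop s₀] with s hs
    exact hmono hs₀ (hs₀.trans hs) hs
  have : 0 < (F s₀ - 2 * K ^ 2) * Real.exp (-(2 / 3) * s₀ ^ (3 / 2 : ℝ)) :=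
    mul_pos (by simp only [hF]; linarith) (Real.exp_pos _)
  linarith

/-! ### Asymptotics of the Hastings–McLeod solution at `-∞`. -/

namespace IsHastingsMcLeod

variable {u : ℝ → ℝ}

theorem hasDerivAt (hu : IsHastingsMcLeod u) (t : ℝ) : HasDerivAt u (deriv u t) t :=
  (hu.differentiable t).hasDerivAt

/-- Painlevé II reads `u'' = 2u (u² + t/2)`, so `u' + (u² + t/2)` and `u' - (u² + t/2)` each satisfy
a linear equation with rate `±2u`. In `s = -t` the sum is stable and the difference unstable. -/
theorem hasDerivAt_add (hu : IsHastingsMcLeod u) (t : ℝ) :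
    HasDerivAt (fun t => deriv u t + u t ^ 2 + t / 2)
      (2 * u t * (deriv u t + u t ^ 2 + t / 2) + 1 / 2) t := by
  refine (((hu.painleve t).add ((hu.hasDerivAt t).pow 2)).add
    ((hasDerivAt_id t).div_const 2)).congr_deriv ?_
  simp
  ring

theorem hasDerivAt_sub (hu : IsHastingsMcLeod u) (t : ℝ) :
    HasDerivAt (fun t => deriv u t - u t ^ 2 - t / 2)
      (-(2 * u t * (deriv u t - u t ^ 2 - t / 2)) - 1 / 2) t := by
  refine (((hu.painleve t).sub ((hu.hasDerivAt t).pow 2)).sub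
    ((hasDerivAt_id t).div_const 2)).congr_deriv ?_
  simp
  ring

theorem eventually_sqrt_le (hu : IsHastingsMcLeod u) :
    ∀ᶠ s : ℝ in atTop, √s ≤ 2 * u (-s) ∧ u (-s) ^ 2 ≤ s := by
  obtain ⟨φ, hφ, hE⟩ := hu.isEquivalent_atBot.exists_eq_mul
  have h1 : ∀ᶠ t in atBot, 3 / 4 < φ t ∧ φ t < 5 / 4 :=
    (hφ.eventually_const_lt (by norm_num)).and (hφ.eventually_lt_const (by norm_num))
  have h2 := tendsto_neg_atTop_atBot.eventually (h1.and hE)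
  filter_upwards [h2, eventually_gt_atTop (0 : ℝ)] with s ⟨⟨h3, h4⟩, h5⟩ hs
  simp only [Pi.mul_apply, neg_neg] at h5
  have hsq : √(s / 2) ^ 2 = s / 2 := Real.sq_sqrt (by linarith)
  have hp : 0 ≤ √(s / 2) := Real.sqrt_nonneg _
  rw [h5]
  constructor
  · refine Real.sqrt_le_iff.2 ⟨by positivity, ?_⟩
    have : (2 * (φ (-s) * √(s / 2))) ^ 2 = 2 * s * φ (-s) ^ 2 := by
      rw [mul_pow, mul_pow, hsq]; ring
    rw [this]; nlinarith [mul_le_mul_of_nonneg_left (show 1 / 2 ≤ φ (-s) ^ 2 by nlinarith) hs.le]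
  · rw [mul_pow, hsq]
    nlinarith [mul_le_mul_of_nonneg_left (show φ (-s) ^ 2 ≤ 2 by nlinarith) hs.le]

theorem hasDerivAt_comp_neg_add (hu : IsHastingsMcLeod u) (s : ℝ) :
    HasDerivAt (fun s => deriv u (-s) + u (-s) ^ 2 + (-s) / 2)
      (-(2 * u (-s) * (deriv u (-s) + u (-s) ^ 2 + (-s) / 2)) + -(1 / 2)) s := by
  refine ((hu.hasDerivAt_add (-s)).scomp s (hasDerivAt_neg s)).congr_deriv ?_
  simp only [smul_eq_mul]; ring

theorem hasDerivAt_comp_neg_sub (hu : IsHastingsMcLeod u) (s : ℝ) :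
    HasDerivAt (fun s => deriv u (-s) - u (-s) ^ 2 - (-s) / 2)
      (2 * u (-s) * (deriv u (-s) - u (-s) ^ 2 - (-s) / 2) + 1 / 2) s := by
  refine ((hu.hasDerivAt_sub (-s)).scomp s (hasDerivAt_neg s)).congr_deriv ?_
  simp only [smul_eq_mul]; ring

theorem hasDerivAt_inv_comp_neg (hu : IsHastingsMcLeod u) {s : ℝ} (hs : u (-s) ≠ 0) :
    HasDerivAt (fun s => 1 / (4 * u (-s))) (deriv u (-s) / (4 * u (-s) ^ 2)) s := by
  have h := (((hu.hasDerivAt (-s)).scomp s (hasDerivAt_neg s)).const_mul 4).inv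
    (by simpa using hs)
  simp only [Function.comp, smul_eq_mul] at h
  have h' : HasDerivAt (fun s => 1 / (4 * u (-s)))
      (-(4 * (-1 * deriv u (-s))) / (4 * u (-s)) ^ 2) s := by
    simp only [one_div]; exact h
  refine h'.congr_deriv ?_
  field_simp

theorem exists_first_bound (hu : IsHastingsMcLeod u) :
    ∃ S C : ℝ, 8 ≤ S ∧ 0 ≤ C ∧ ∀ s, S ≤ s → √s ≤ 2 * u (-s) ∧ u (-s) ^ 2 ≤ s ∧
      (deriv u (-s) + u (-s) ^ 2 + (-s) / 2) ^ 2 * s ≤ C ∧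
      (deriv u (-s) - u (-s) ^ 2 - (-s) / 2) ^ 2 * s ≤ C := by
  obtain ⟨S₀, hS₀⟩ := eventually_atTop.1 hu.eventually_sqrt_le
  set S := max S₀ 8
  have hS : 8 ≤ S := le_max_right _ _
  have hS' : ∀ s, S ≤ s → √s ≤ 2 * u (-s) ∧ u (-s) ^ 2 ≤ s :=
    fun s hs => hS₀ s ((le_max_left _ _).trans hs)
  obtain ⟨C, hC⟩ := sq_mul_pow_bounded_of_stable (K := 1 / 2) 0 (by norm_num; linarith)
    (fun s _ => hu.hasDerivAt_comp_neg_add s) (fun s hs => (hS' s hs).1)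
    (fun s _ => by norm_num)
  -- The a priori polynomial growth comes from the bound already found for the stable quantity and
  -- from `u² ≤ s`, since the two quantities differ by `2(u² - s/2)`.
  have hB := sq_mul_pow_bounded_of_unstable (K := 1 / 2) 0 3 (by norm_num; linarith)
    (fun s _ => hu.hasDerivAt_comp_neg_sub s) (fun s hs => (hS' s hs).1)
    (fun s _ => by norm_num) (by
      refine IsBigO.of_bound (2 * |C| + 8) ?_
      filter_upwards [eventually_ge_atTop S] with s hs
      have h1 := hC s hs
      have h2 := (hS' s hs).2
      simp only [zero_add, pow_one] at h1 ⊢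
      have hs0 : 0 ≤ s := by linarith
      rw [Real.norm_of_nonneg (by positivity), Real.norm_of_nonneg (by positivity)]
      have h3 : (u (-s) ^ 2 - s / 2) ^ 2 ≤ s ^ 2 := by
        apply sq_le_sq'
        · nlinarith [sq_nonneg (u (-s))]
        · linarith
      have h4 : (deriv u (-s) - u (-s) ^ 2 - -s / 2) ^ 2 ≤
          2 * (deriv u (-s) + u (-s) ^ 2 + -s / 2) ^ 2 + 8 * (u (-s) ^ 2 - s / 2) ^ 2 := by
        nlinarith [sq_nonneg ((deriv u (-s) + u (-s) ^ 2 + -s / 2) + 2 * (u (-s) ^ 2 - s / 2))]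
      have h5 : |C| ≤ |C| * s ^ 3 :=
        le_mul_of_one_le_right (abs_nonneg C) (one_le_pow₀ (by linarith))
      have h6 := mul_le_mul_of_nonneg_right h4 hs0
      have h7 := mul_le_mul_of_nonneg_right h3 hs0
      nlinarith [le_abs_self C])
  refine ⟨S, max C (1 / 2), hS, le_max_of_le_right (by norm_num), fun s hs =>
    ⟨(hS' s hs).1, (hS' s hs).2, ?_, ?_⟩⟩
  · simpa using le_max_of_le_left (hC s hs)
  · have h := hB s hs
    simp only [zero_add, pow_one] at h
    exact le_max_of_le_right (by linarith)

/-- Adding `1/(4u)`, the quasi-stationary correction, replaces the constant forcing `∓1/2` by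
`u'/(4u²)`. The first bound gives `u' = O(s^(-1/2))`, so the new forcing is `O(s^(-3/2))` and the
scalar lemmas apply with `m = 3`. -/
theorem exists_second_bound (hu : IsHastingsMcLeod u) :
    ∃ S C : ℝ, 8 ≤ S ∧ 0 ≤ C ∧ ∀ s, S ≤ s → √s ≤ 2 * u (-s) ∧ u (-s) ^ 2 ≤ s ∧
      |deriv u (-s) + u (-s) ^ 2 + (-s) / 2 + 1 / (4 * u (-s))| ≤ C / s ^ 2 ∧
      |deriv u (-s) - u (-s) ^ 2 - (-s) / 2 + 1 / (4 * u (-s))| ≤ C / s ^ 2 := by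
  obtain ⟨S, C, hS, hC, H⟩ := hu.exists_first_bound
  have hpos : ∀ s, S ≤ s → 0 < u (-s) := fun s hs => by
    have := (H s hs).1
    have : 0 < √s := Real.sqrt_pos.2 (by linarith)
    linarith
  have hlow : ∀ s, S ≤ s → s ≤ 4 * u (-s) ^ 2 := fun s hs => by
    have h1 := Real.sqrt_le_iff.1 (H s hs).1
    nlinarith [h1.2]
  have hg : ∀ s, S ≤ s → (deriv u (-s) / (4 * u (-s) ^ 2)) ^ 2 * s ^ 3 ≤ √C ^ 2 := by
    intro s hs
    have h1 := hlow s hs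
    obtain ⟨-, -, h2, h3⟩ := H s hs
    have hs0 : 0 < s := by linarith
    rw [Real.sq_sqrt hC, div_pow, div_mul_eq_mul_div, div_le_iff₀ (by have := hpos s hs; positivity)]
    have h4 : s ^ 2 ≤ (4 * u (-s) ^ 2) ^ 2 := pow_le_pow_left₀ hs0.le h1 2
    have h5 : deriv u (-s) ^ 2 * s ≤ C := by
      nlinarith [mul_nonneg hs0.le (sq_nonneg (u (-s) ^ 2 + -s / 2))]
    calc deriv u (-s) ^ 2 * s ^ 3 = (deriv u (-s) ^ 2 * s) * s ^ 2 := by ring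
      _ ≤ C * (4 * u (-s) ^ 2) ^ 2 := by gcongr
  obtain ⟨C₁, hC₁⟩ := sq_mul_pow_bounded_of_stable (K := √C) (S := S)
    (y := fun s => deriv u (-s) + u (-s) ^ 2 + (-s) / 2 + 1 / (4 * u (-s)))
    (p := fun s => 2 * u (-s)) (g := fun s => deriv u (-s) / (4 * u (-s) ^ 2)) 3
    (by norm_num; linarith)
    (fun s hs => by
      refine ((hu.hasDerivAt_comp_neg_add s).add
        (hu.hasDerivAt_inv_comp_neg (hpos s hs).ne')).congr_deriv ?_
      have := (hpos s hs).ne'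
      field_simp
      ring) (fun s hs => (H s hs).1) hg
  have hC₂ := sq_mul_pow_bounded_of_unstable (K := √C) (S := S)
    (y := fun s => deriv u (-s) - u (-s) ^ 2 - (-s) / 2 + 1 / (4 * u (-s)))
    (p := fun s => 2 * u (-s)) (g := fun s => deriv u (-s) / (4 * u (-s) ^ 2)) 3 3
    (by norm_num; linarith)
    (fun s hs => by
      refine ((hu.hasDerivAt_comp_neg_sub s).add
        (hu.hasDerivAt_inv_comp_neg (hpos s hs).ne')).congr_deriv ?_
      have := (hpos s hs).ne'
      field_simp
      ring) (fun s hs => (H s hs).1) hg (by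
      refine IsBigO.of_bound (2 * C + 1) ?_
      filter_upwards [eventually_ge_atTop S] with s hs
      have h1 := hlow s hs
      have h2 := (H s hs).2.2.2
      have hs0 : 0 < s := by linarith
      have hu0 := hpos s hs
      rw [Real.norm_of_nonneg (by positivity), Real.norm_of_nonneg (by positivity)]
      have h3 : (1 / (4 * u (-s))) ^ 2 * s ≤ 1 / 4 := by
        rw [div_pow, div_mul_eq_mul_div, div_le_iff₀ (by positivity)]
        linarith
      have h4 : (deriv u (-s) - u (-s) ^ 2 - -s / 2 + 1 / (4 * u (-s))) ^ 2 * s ≤ 2 * C + 1 := by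
        nlinarith [mul_nonneg hs0.le
          (sq_nonneg (deriv u (-s) - u (-s) ^ 2 - -s / 2 - 1 / (4 * u (-s))))]
      calc _ = ((deriv u (-s) - u (-s) ^ 2 - -s / 2 + 1 / (4 * u (-s))) ^ 2 * s) * s ^ 3 := by ring
        _ ≤ _ := by gcongr)
  have key : ∀ s y D : ℝ, S ≤ s → y ^ 2 * s ^ 4 ≤ D → |y| ≤ √D / s ^ 2 := by
    intro s y D hs h
    have hs0 : 0 < s := by linarith
    rw [le_div_iff₀ (by positivity)]
    refine Real.le_sqrt_of_sq_le ?_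
    rw [mul_pow, sq_abs, ← pow_mul]
    exact h
  refine ⟨S, max √C₁ √(2 * √C ^ 2), hS, le_max_of_le_left (Real.sqrt_nonneg _), fun s hs =>
    ⟨(H s hs).1, (H s hs).2.1, ?_, ?_⟩⟩
  · refine (key s _ _ hs (hC₁ s hs)).trans ?_
    gcongr; exact le_max_left _ _
  · refine (key s _ _ hs (hC₂ s hs)).trans ?_
    gcongr; exact le_max_right _ _

/-- The two-term asymptotics of `u' / u` and `u ^ 2` at `-∞`. -/
theorem exists_asymptotics (hu : IsHastingsMcLeod u) :
    ∃ S C : ℝ, 8 ≤ S ∧ ∀ s, S ≤ s → 1 ≤ u (-s) ∧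
      |deriv u (-s) / u (-s) + 1 / (2 * s)| ≤ C / s ^ 2 ∧
      |u (-s) ^ 2 - s / 2| ≤ C / s ^ 2 ∧
      deriv u (-s) - u (-s) ^ 2 - (-s) / 2 < 0 := by
  obtain ⟨S, C, hS, hC, H⟩ := hu.exists_second_bound
  refine ⟨max S (4 * C + 1), 3 * C, le_max_of_le_left hS, fun s hs => ?_⟩
  obtain ⟨h1, h2, h3, h4⟩ := H s ((le_max_left _ _).trans hs)
  have hs8 : 8 ≤ s := hS.trans ((le_max_left _ _).trans hs)
  have hsC : 4 * C < s := by linarith [(le_max_right S (4 * C + 1)).trans hs]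
  have hs0 : 0 < s := by linarith
  have hu1 : 1 ≤ u (-s) := by
    have : 2 ≤ √s := Real.le_sqrt_of_sq_le (by linarith)
    linarith
  have hu0 : 0 < u (-s) := by linarith
  have hus : u (-s) ≤ s := by nlinarith
  have hk : |u (-s) ^ 2 - s / 2| ≤ C / s ^ 2 := by
    rw [abs_le] at h3 h4 ⊢
    constructor <;> linarith [h3.1, h3.2, h4.1, h4.2]
  have hCs : 0 ≤ C / s ^ 2 := by positivity
  refine ⟨hu1, ?_, ?_, ?_⟩
  · have hr : deriv u (-s) / u (-s) + 1 / (2 * s) = (u (-s) ^ 2 - s / 2) * (1 / (2 * s * u (-s) ^ 2))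
        + ((deriv u (-s) + u (-s) ^ 2 + (-s) / 2 + 1 / (4 * u (-s)))
          + (deriv u (-s) - u (-s) ^ 2 - (-s) / 2 + 1 / (4 * u (-s)))) * (1 / (2 * u (-s))) := by
      field_simp
      ring
    rw [hr]
    refine (abs_add_le _ _).trans ?_
    rw [abs_mul, abs_mul, abs_of_pos (show 0 < 1 / (2 * s * u (-s) ^ 2) by positivity),
      abs_of_pos (show 0 < 1 / (2 * u (-s)) by positivity)]
    have e1 : 1 / (2 * s * u (-s) ^ 2) ≤ 1 := by
      rw [div_le_one (by positivity)]; nlinarith [mul_pos hs0 hu0]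
    have e2 : 1 / (2 * u (-s)) ≤ 1 := by
      rw [div_le_one (by positivity)]; linarith
    have e3 := mul_le_mul hk e1 (by positivity) hCs
    have e4 := mul_le_mul ((abs_add_le _ _).trans (add_le_add h3 h4)) e2 (by positivity)
      (add_nonneg hCs hCs)
    calc _ ≤ _ := add_le_add e3 e4
      _ = 3 * C / s ^ 2 := by ring
  · refine hk.trans ?_
    gcongr; linarith
  -- The correction `-1/(4u)` dominates the error because `u ≤ s` and `4C < s`.
  · have h5 : C / s ^ 2 < 1 / (4 * u (-s)) := by
      rw [div_lt_div_iff₀ (by positivity) (by positivity)]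
      nlinarith
    linarith [(abs_le.1 h4).2]

/-- The sign is known near `-∞` from the asymptotics. The equation for `u' - u² - t/2` has forcing
`-1/2`, so after multiplication by an integrating factor the quantity decreases and stays negative
to the right. -/
theorem deriv_lt (hu : IsHastingsMcLeod u) (t : ℝ) : deriv u t < u t ^ 2 + t / 2 := by
  obtain ⟨S, C, -, H⟩ := hu.exists_asymptotics
  have hcont : Continuous u := hu.differentiable.continuous
  set U : ℝ → ℝ := fun t => ∫ x in (0 : ℝ)..t, u x
  have hU : ∀ t, HasDerivAt U (u t) t := fun t =>
    intervalIntegral.integral_hasDerivAt_right (hcont.intervalIntegrable _ _)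
      (hcont.stronglyMeasurableAtFilter _ _) hcont.continuousAt
  have hanti : Antitone fun t => (deriv u t - u t ^ 2 - t / 2) * Real.exp (2 * U t) := by
    refine antitone_of_hasDerivAt_nonpos (f' := fun t => -(1 / 2) * Real.exp (2 * U t))
      (fun t => ?_) (fun t => ?_)
    · refine ((hu.hasDerivAt_sub t).mul ((hU t).const_mul 2).exp).congr_deriv ?_
      ring
    · have := Real.exp_pos (2 * U t)
      simp only [Pi.zero_apply]
      linarith
  have h1 := (H (max S (-t)) (le_max_left _ _)).2.2.2
  have h2 := hanti (show -max S (-t) ≤ t by linarith [le_max_right S (-t)])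
  have h3 := mul_neg_of_neg_of_pos h1 (Real.exp_pos (2 * U (-max S (-t))))
  have h4 : (deriv u t - u t ^ 2 - t / 2) * Real.exp (2 * U t) < 0 := lt_of_le_of_lt h2 h3
  have h5 := (neg_of_mul_neg_left h4 (Real.exp_pos _).le)
  linarith

end IsHastingsMcLeod

/-! ### Gronwall inequalities, forward and backward in time. -/

theorem le_mul_exp_of_hasDerivWithinAt_Icc {f f' : ℝ → ℝ} {a b M : ℝ} (hab : a ≤ b)
    (hf : ∀ t ∈ Set.Icc a b, HasDerivWithinAt f (f' t) (Set.Icc a b) t)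
    (h : ∀ t ∈ Set.Icc a b, f' t ≤ M * f t) : f b ≤ f a * Real.exp (M * (b - a)) := by
  have hg : ∀ t ∈ Set.Icc a b, HasDerivWithinAt (fun t => f t * Real.exp (-M * t))
      ((f' t - M * f t) * Real.exp (-M * t)) (Set.Icc a b) t := by
    intro t ht
    refine ((hf t ht).mul (((hasDerivAt_id t).const_mul (-M)).exp.hasDerivWithinAt)).congr_deriv ?_
    simp only [id]
    ring
  have hanti : AntitoneOn (fun t => f t * Real.exp (-M * t)) (Set.Icc a b) := by
    refine antitoneOn_of_hasDerivWithinAt_nonpos (convex_Icc a b)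
      (fun t ht => (hg t ht).continuousWithinAt)
      (fun t ht => (hg t (interior_subset ht)).mono interior_subset) fun t ht => ?_
    exact mul_nonpos_of_nonpos_of_nonneg (by linarith [h t (interior_subset ht)])
      (Real.exp_pos _).le
  have h1 := hanti ⟨le_rfl, hab⟩ ⟨hab, le_rfl⟩ hab
  have h2 := mul_le_mul_of_nonneg_right h1 (Real.exp_pos (M * b)).le
  simp only [mul_assoc, ← Real.exp_add] at h2
  rw [show -M * b + M * b = 0 by ring, Real.exp_zero, mul_one,
    show -M * a + M * b = M * (b - a) by ring] at h2
  exact h2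

theorem le_mul_exp_of_abs_deriv_le {f f' : ℝ → ℝ} {a b M : ℝ}
    (hf : ∀ t ∈ Set.uIcc a b, HasDerivWithinAt f (f' t) (Set.uIcc a b) t)
    (h : ∀ t ∈ Set.uIcc a b, |f' t| ≤ M * f t) : f b ≤ f a * Real.exp (M * |b - a|) := by
  rcases le_total a b with hab | hab
  · rw [Set.uIcc_of_le hab] at hf h
    rw [abs_of_nonneg (by linarith)]
    exact le_mul_exp_of_hasDerivWithinAt_Icc hab hf fun t ht => (le_abs_self _).trans (h t ht)
  · rw [Set.uIcc_of_ge hab] at hf h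
    rw [abs_of_nonpos (by linarith), show -(b - a) = -b - -a by ring]
    have hmem : ∀ t ∈ Set.Icc (-a) (-b), -t ∈ Set.Icc b a := fun t ht =>
      ⟨by linarith [ht.2], by linarith [ht.1]⟩
    have := le_mul_exp_of_hasDerivWithinAt_Icc (f := fun t => f (-t)) (f' := fun t => -f' (-t))
      (M := M) (show -a ≤ -b by linarith) (fun t ht => by
        refine ((hf (-t) (hmem t ht)).scomp t (hasDerivAt_neg t).hasDerivWithinAt
          (fun x hx => hmem x hx)).congr_deriv ?_
        simp) (fun t ht => (neg_le_abs _).trans (h _ (hmem t ht)))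
    simpa using this

/-! ### The Hastings–McLeod solution has no zeros. -/

namespace IsHastingsMcLeod

variable {u : ℝ → ℝ}

/-- At a zero `t < 0`, `deriv_lt` forces `u' < t/2 < 0`. If `u'` stays negative, `u` is negative and
decreasing, so it cannot tend to `0`. The work lies in excluding a first point `z` where `u' ≥ 0`.
-/
theorem ne_zero_of_neg (hu : IsHastingsMcLeod u) {t : ℝ} (ht : t < 0) : u t ≠ 0 := by
  intro h0
  have hcd : Continuous (deriv u) :=
    continuous_iff_continuousAt.2 fun t => (hu.painleve t).continuousAt
  have hd0 : deriv u t < t / 2 := by simpa [h0] using hu.deriv_lt t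
  have hneg : ∀ x, t ≤ x → deriv u x < 0 := by
    by_contra! hcon
    obtain ⟨x, htx, hx⟩ := hcon
    obtain ⟨z, ⟨hz, hmin⟩⟩ : ∃ z, IsLeast (Set.Icc t x ∩ deriv u ⁻¹' Set.Ici 0) z :=
      (isCompact_Icc.inter_right (isClosed_Ici.preimage hcd)).exists_isLeast ⟨x, ⟨htx, le_rfl⟩, hx⟩
    have hz0 : 0 ≤ deriv u z := hz.2
    have hlt : ∀ y, t ≤ y → y < z → deriv u y < 0 := by
      intro y hy hyz
      by_contra! hcon
      exact absurd (hmin ⟨⟨hy, hyz.le.trans hz.1.2⟩, hcon⟩) (not_le.2 hyz)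
    have hanti : AntitoneOn u (Set.Icc t z) :=
      antitoneOn_of_deriv_nonpos (convex_Icc t z) hu.differentiable.continuous.continuousOn
        hu.differentiable.differentiableOn fun y hy => by
          rw [interior_Icc] at hy; exact (hlt y hy.1.le hy.2).le
    have hu0 : ∀ y ∈ Set.Icc t z, u y ≤ 0 := fun y hy => by
      rw [← h0]; exact hanti ⟨le_rfl, hz.1.1⟩ hy hy.1
    have hAz : 0 < deriv u z + u z ^ 2 + z / 2 := by
      have := hu.deriv_lt z
      linarith
    -- The sum `u' + u² + t/2` goes from negative at `t` to positive at `z`. From a zero `w` on it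
    -- stays nonnegative, which with `deriv_lt` gives `u² + y/2 ≥ 0`. Then `u'' = 2u (u² + y/2) ≤ 0`
    -- because `u ≤ 0`, so `u'` cannot rise from its negative value at `w`.
    obtain ⟨w, hw, hAw⟩ : (0 : ℝ) ∈ (fun t => deriv u t + u t ^ 2 + t / 2) '' Set.Icc t z := by
      refine intermediate_value_Icc hz.1.1 (fun y _ => (hu.hasDerivAt_add y).continuousAt.continuousWithinAt) ⟨?_, hAz.le⟩
      simp only [h0]; linarith
    have hdw : deriv u w < 0 := by
      have := hu.deriv_lt w
      simp only at hAw
      linarith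
    have hAnn : ∀ y ∈ Set.Icc w z, 0 ≤ deriv u y + u y ^ 2 + y / 2 := by
      intro y hy
      by_contra! hcon
      set U : ℝ → ℝ := fun t => ∫ x in (0 : ℝ)..t, u x
      have hcont := hu.differentiable.continuous
      have hU : ∀ t, HasDerivAt U (u t) t := fun t =>
        intervalIntegral.integral_hasDerivAt_right (hcont.intervalIntegrable _ _)
          (hcont.stronglyMeasurableAtFilter _ _) hcont.continuousAt
      have hmono : Monotone fun t => (deriv u t + u t ^ 2 + t / 2) * Real.exp (-2 * U t) := by
        refine monotone_of_hasDerivAt_nonneg (f' := fun t => 1 / 2 * Real.exp (-2 * U t))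
          (fun t => ?_) (fun t => ?_)
        · refine ((hu.hasDerivAt_add t).mul ((hU t).const_mul (-2)).exp).congr_deriv ?_
          ring
        · simp only [Pi.zero_apply]; positivity
      have h1 := hmono hy.1
      simp only at h1 hAw
      rw [hAw, zero_mul] at h1
      exact absurd h1 (not_le.2 (mul_neg_of_neg_of_pos hcon (Real.exp_pos _)))
    have hanti' : AntitoneOn (deriv u) (Set.Icc w z) := by
      refine antitoneOn_of_hasDerivWithinAt_nonpos (convex_Icc w z) hcd.continuousOn
        (fun y _ => (hu.painleve y).hasDerivWithinAt) fun y hy => ?_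
      have hy' := interior_subset hy
      have h1 := hAnn y hy'
      have h2 := hu.deriv_lt y
      have h3 := hu0 y ⟨hw.1.trans hy'.1, hy'.2⟩
      nlinarith
    have := hanti' ⟨le_rfl, hw.2⟩ ⟨hw.2, le_rfl⟩ hw.2
    linarith
  have hanti : StrictAntiOn u (Set.Ici t) :=
    strictAntiOn_of_deriv_neg (convex_Ici t) hu.differentiable.continuous.continuousOn
      fun y hy => by rw [interior_Ici] at hy; exact hneg y (le_of_lt hy)
  have h1 : u (t + 1) < 0 := by
    rw [← h0]; exact hanti (by simp) (by simp) (by simp)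
  have h2 : (0 : ℝ) ≤ u (t + 1) := by
    refine le_of_tendsto hu.tendsto_atTop ?_
    filter_upwards [eventually_ge_atTop (t + 1)] with x hx
    exact hanti.antitoneOn (by simp) (by simp; linarith) hx
  linarith

/-- For `x ≥ 0`, `(u u')' ≥ 0`. After a zero `u²` is therefore nondecreasing, yet it tends to `0`,
so `u` vanishes to the right. Gronwall for `u² + u'²` carries the zero Cauchy data back to `0`,
where `deriv_lt` would read `0 < 0`. -/
theorem ne_zero_of_nonneg (hu : IsHastingsMcLeod u) {t : ℝ} (ht : 0 ≤ t) : u t ≠ 0 := by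
  intro h0
  have hsq : ∀ x, HasDerivAt (fun x => u x ^ 2) (2 * (u x * deriv u x)) x := fun x =>
    ((hu.hasDerivAt x).pow 2).congr_deriv (by simp; ring)
  have hprod : ∀ x, HasDerivAt (fun x => u x * deriv u x)
      (deriv u x ^ 2 + u x ^ 2 * (x + 2 * u x ^ 2)) x := fun x =>
    ((hu.hasDerivAt x).mul (hu.painleve x)).congr_deriv (by ring)
  have hmono := monotoneOn_Ici_of_hasDerivAt_nonneg (S := t) (fun x _ => hprod x)
    (fun x hx => by have : 0 ≤ x := ht.trans hx; positivity)
  have hmono2 := monotoneOn_Ici_of_hasDerivAt_nonneg (S := t) (fun x _ => hsq x) (fun x hx => by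
    have := hmono (le_refl t) hx hx
    simp only [h0, zero_mul] at this
    linarith)
  have hz : ∀ x, t ≤ x → u x = 0 := by
    intro x hx
    have h1 : u x ^ 2 ≤ 0 := by
      have h2 : Tendsto (fun x => u x ^ 2) atTop (𝓝 0) := by simpa using hu.tendsto_atTop.pow 2
      refine ge_of_tendsto h2 ?_
      filter_upwards [eventually_ge_atTop x] with y hy
      exact hmono2 hx (hx.trans hy) hy
    exact pow_eq_zero_iff (two_ne_zero) |>.1 (le_antisymm h1 (sq_nonneg _))
  have hd0 : deriv u t = 0 := by
    have h1 : HasDerivWithinAt u 0 (Set.Ici t) t :=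
      (hasDerivWithinAt_const t (Set.Ici t) (0 : ℝ)).congr (fun x hx => hz x hx) h0
    exact (uniqueDiffOn_Ici t t (Set.self_mem_Ici)).eq_deriv _
      (hu.hasDerivAt t).hasDerivWithinAt h1
  obtain ⟨M, hM⟩ := isCompact_uIcc.exists_bound_of_continuousOn (s := Set.uIcc t 0)
    (f := fun x => x + 2 * u x ^ 2)
    (by have := hu.differentiable.continuous; fun_prop)
  have hw : ∀ x, HasDerivAt (fun x => u x ^ 2 + deriv u x ^ 2)
      (2 * u x * deriv u x * (1 + (x + 2 * u x ^ 2))) x := fun x =>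
    ((hsq x).add ((hu.painleve x).pow 2)).congr_deriv (by simp; ring)
  have h := le_mul_exp_of_abs_deriv_le (a := t) (b := 0) (M := 1 + M)
    (fun x _ => (hw x).hasDerivWithinAt) (fun x hx => by
      have h1 := hM x hx
      rw [Real.norm_eq_abs] at h1
      rw [abs_mul, mul_comm (1 + M)]
      refine mul_le_mul ?_ ?_ (abs_nonneg _) (by positivity)
      · exact abs_le.2 ⟨by nlinarith [sq_nonneg (u x + deriv u x)],
          by nlinarith [sq_nonneg (u x - deriv u x)]⟩
      · exact (abs_add_le _ _).trans (by simpa using h1))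
  simp only [h0, hd0] at h
  norm_num at h
  have h1 : u 0 = 0 := by nlinarith [sq_nonneg (u 0), sq_nonneg (deriv u 0)]
  have h2 : deriv u 0 = 0 := by nlinarith [sq_nonneg (u 0), sq_nonneg (deriv u 0)]
  have := hu.deriv_lt 0
  rw [h1, h2] at this
  norm_num at this

theorem ne_zero (hu : IsHastingsMcLeod u) (t : ℝ) : u t ≠ 0 :=
  (lt_or_ge t 0).elim hu.ne_zero_of_neg hu.ne_zero_of_nonneg

theorem continuous_deriv_div (hu : IsHastingsMcLeod u) : Continuous fun t => deriv u t / u t :=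
  (continuous_iff_continuousAt.2 fun t => (hu.painleve t).continuousAt).div
    hu.differentiable.continuous hu.ne_zero

end IsHastingsMcLeod

/-! ### The exact equations for the difference of two solutions. -/

/-- The increment of the right-hand side of the `q`-equation when `(q, α)` is replaced by
`(q + Q, α + P)`; `r` stands for `u' / u`. -/
noncomputable def qIncrement (r q α Q P : ℝ) : ℝ :=
  (2 / 3 * α + r / 3 * (1 - 2 * q) + 2 / 3 * P - r / 3 * Q) * Q + 2 / 3 * q * P

/-- The increment of the right-hand side of the `α`-equation when `(q, α)` is replaced by
`(q + Q, α + P)`; `r` stands for `u' / u` and `k` for `u ^ 2 + t / 2`. -/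
noncomputable def alphaIncrement (r k q α Q P : ℝ) : ℝ :=
  (4 / 3 * α + r / 3 * (2 - q) + 2 / 3 * P - r / 3 * Q) * P - (r / 3 * α + k / 3) * Q

/-- Shifting the base point turns a difference of increments into a single increment, so the size
bounds below also give Lipschitz bounds. -/
theorem qIncrement_sub (r q α Q P Q' P' : ℝ) :
    qIncrement r q α Q P - qIncrement r q α Q' P'
      = qIncrement r (q + Q') (α + P') (Q - Q') (P - P') := by
  unfold qIncrement; ring

theorem alphaIncrement_sub (r k q α Q P Q' P' : ℝ) :
    alphaIncrement r k q α Q P - alphaIncrement r k q α Q' P'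
      = alphaIncrement r k (q + Q') (α + P') (Q - Q') (P - P') := by
  unfold alphaIncrement; ring

theorem qIncrement_eq (r q α Q P : ℝ) :
    2 / 3 * (α + P) * (q + Q) + r * ((1 + (q + Q)) * (2 - (q + Q)) / 3)
      = 2 / 3 * α * q + r * ((1 + q) * (2 - q) / 3) + qIncrement r q α Q P := by
  unfold qIncrement; ring

theorem alphaIncrement_eq (r v t q α Q P : ℝ) :
    (α + P) * (2 / 3 * (α + P) + r * ((2 - (q + Q)) / 3)) - t / 6 * (1 + (q + Q))
        - v ^ 2 / 3 * (3 + (q + Q))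
      = α * (2 / 3 * α + r * ((2 - q) / 3)) - t / 6 * (1 + q) - v ^ 2 / 3 * (3 + q)
        + alphaIncrement r (v ^ 2 + t / 2) q α Q P := by
  unfold alphaIncrement; ring

theorem abs_mul_add_mul_le {a b x y c d : ℝ} (hx : |x| ≤ d) (hy : |y| ≤ d)
    (hab : |a| + |b| ≤ c) : |a * x + b * y| ≤ c * d := by
  have hd : 0 ≤ d := (abs_nonneg x).trans hx
  calc |a * x + b * y| ≤ |a * x| + |b * y| := abs_add_le _ _
    _ = |a| * |x| + |b| * |y| := by rw [abs_mul, abs_mul]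
    _ ≤ |a| * d + |b| * d := by gcongr
    _ = (|a| + |b|) * d := by ring
    _ ≤ c * d := by gcongr

theorem abs_mul_le_sq {a b M : ℝ} (ha : |a| ≤ M) (hb : |b| ≤ M) : |a * b| ≤ M ^ 2 := by
  rw [abs_mul, sq]; exact mul_le_mul ha hb (abs_nonneg _) ((abs_nonneg _).trans ha)

theorem abs_qIncrement_le {r q α Q P M d : ℝ} (hr : |r| ≤ M) (hq : |q| ≤ M) (hα : |α| ≤ M)
    (hQ : |Q| ≤ M) (hP : |P| ≤ M) (hQd : |Q| ≤ d) (hPd : |P| ≤ d) :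
    |qIncrement r q α Q P| ≤ 3 * (M + 1) ^ 2 * d := by
  refine abs_mul_add_mul_le hQd hPd ?_
  have hM : 0 ≤ M := (abs_nonneg r).trans hr
  have h1 := abs_le.1 (abs_mul_le_sq hr hq)
  have h2 := abs_le.1 (abs_mul_le_sq hr hQ)
  rw [abs_le] at hr hα hP
  have h3 : |2 / 3 * q| ≤ 2 / 3 * M := by
    rw [abs_mul, abs_of_pos (by norm_num : (0 : ℝ) < 2 / 3)]; gcongr
  have h4 : |2 / 3 * α + r / 3 * (1 - 2 * q) + 2 / 3 * P - r / 3 * Q| ≤ 5 / 3 * M + M ^ 2 := by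
    rw [abs_le]; constructor <;> linarith [h1.1, h1.2, h2.1, h2.2, hr.1, hr.2, hα.1, hα.2, hP.1, hP.2]
  nlinarith

theorem abs_alphaIncrement_le {r k q α Q P M d : ℝ} (hr : |r| ≤ M) (hk : |k| ≤ M) (hq : |q| ≤ M)
    (hα : |α| ≤ M) (hQ : |Q| ≤ M) (hP : |P| ≤ M) (hQd : |Q| ≤ d) (hPd : |P| ≤ d) :
    |alphaIncrement r k q α Q P| ≤ 3 * (M + 1) ^ 2 * d := by
  have hM : 0 ≤ M := (abs_nonneg r).trans hr
  have h1 := abs_le.1 (abs_mul_le_sq hr hq)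
  have h2 := abs_le.1 (abs_mul_le_sq hr hQ)
  have h3 := abs_le.1 (abs_mul_le_sq hr hα)
  rw [abs_le] at hr hα hP hk
  have h4 : |4 / 3 * α + r / 3 * (2 - q) + 2 / 3 * P - r / 3 * Q| ≤ 8 / 3 * M + 2 / 3 * M ^ 2 := by
    rw [abs_le]; constructor <;> linarith [h1.1, h1.2, h2.1, h2.2, hr.1, hr.2, hα.1, hα.2, hP.1, hP.2]
  have h5 : |-(r / 3 * α + k / 3)| ≤ 1 / 3 * M + 1 / 3 * M ^ 2 := by
    rw [abs_le]; constructor <;> linarith [h3.1, h3.2, hk.1, hk.2]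
  have h6 := abs_mul_add_mul_le hPd hQd (le_refl (|4 / 3 * α + r / 3 * (2 - q) + 2 / 3 * P
    - r / 3 * Q| + |-(r / 3 * α + k / 3)|))
  have hd : 0 ≤ d := (abs_nonneg _).trans hQd
  unfold alphaIncrement
  rw [sub_eq_add_neg, ← neg_mul]
  refine h6.trans (mul_le_mul_of_nonneg_right ?_ hd)
  nlinarith

/-! ### The energy estimate and exponential decay. -/

set_option maxHeartbeats 1000000 in
/-- Pointwise form of the dissipation estimate for `E = Q ^ 2 + (s P + Q / 4) ^ 2`. -/
theorem energy_estimate {s l e₁ e₂ q k M Q P R n : ℝ} (hl : 0.47 ≤ l) (hl' : l ≤ 0.48)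
    (hM : 1 ≤ M) (hs : 8 * M ^ 2 ≤ s) (he₁ : |e₁| ≤ M / s ^ 2)
    (he₂ : |e₂| ≤ (M - 1) / s ^ 2) (hq : |q| ≤ M / s) (hk : |k| ≤ M / s ^ 2)
    (hR : R = s * P + Q / 4) (hn : 0 ≤ n) (hE : Q ^ 2 + R ^ 2 = n ^ 2) :
    Q * -qIncrement (-(1 / (2 * s)) + e₂) q (3 / 2 * l * √s - 1 / (8 * s) + e₁) Q P
      + R * (P + s * -alphaIncrement (-(1 / (2 * s)) + e₂) k q
          (3 / 2 * l * √s - 1 / (8 * s) + e₁) Q P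
        + -qIncrement (-(1 / (2 * s)) + e₂) q (3 / 2 * l * √s - 1 / (8 * s) + e₁) Q P / 4)
      ≤ (1 / (4 * s) - l * √s + 14 * M ^ 4 / (s * √s) + 7 * M / s * n) * n ^ 2 := by
  have hs8 : 8 ≤ s := by nlinarith
  have hs0 : 0 < s := by linarith
  set σ := √s with hσdef
  have hσ : 1 ≤ σ := Real.one_le_sqrt.2 (by linarith)
  have hσ2 : σ ^ 2 = s := Real.sq_sqrt hs0.le
  have hPR : P = (R - Q / 4) / s := by rw [hR]; field_simp; ring
  have hQn : |Q| ≤ n := abs_le_of_sq_le_sq (by nlinarith [sq_nonneg R]) hn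
  have hRn : |R| ≤ n := abs_le_of_sq_le_sq (by nlinarith [sq_nonneg Q]) hn
  have hsi : 0 < 1 / s := by positivity
  set i := 1 / s with hi
  have hsi1 : s * i = 1 := by rw [hi]; field_simp
  have hi8 : i ≤ 1 / 8 := by rw [hi]; gcongr
  have hMi : M ^ 2 * i ≤ 1 / 8 := by linarith [mul_le_mul_of_nonneg_right hs hsi.le]
  have e1 : 1 / (2 * s) = i / 2 := by rw [hi]; field_simp
  have e2 : 1 / (8 * s) = i / 8 := by rw [hi]; field_simp
  have e3 : 1 / (4 * s) = i / 4 := by rw [hi]; field_simp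
  have e4 : ∀ x : ℝ, x / s ^ 2 = x * i ^ 2 := fun x => by rw [hi]; field_simp
  have e5 : ∀ x : ℝ, x / s = x * i := fun x => by rw [hi]; field_simp
  have e6 : 14 * M ^ 4 / (s * σ) = 14 * M ^ 4 * i ^ 2 * σ := by
    rw [hi]; field_simp; rw [hσ2]
  rw [e4] at he₁ he₂ hk
  rw [e5] at hq hPR
  rw [e1, e2, e3, e5, e6]
  set r := -(i / 2) + e₂ with hr
  set α := 3 / 2 * l * σ - i / 8 + e₁ with hα
  have hMM : M ≤ M ^ 2 := le_self_pow₀ hM (by norm_num)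
  have hMi2 : M * i ≤ 1 / 8 := (mul_le_mul_of_nonneg_right hMM hsi.le).trans hMi
  have hi2 : M * i ^ 2 ≤ i / 8 := by linarith [mul_le_mul_of_nonneg_right hMi2 hsi.le]
  have hMi3 : M ^ 2 * i ^ 2 ≤ i / 8 := by linarith [mul_le_mul_of_nonneg_right hMi hsi.le]
  have hi2' : 0 < i ^ 2 := by positivity
  have hMi22 : M * i ^ 2 ≤ M ^ 2 * i ^ 2 := by gcongr
  -- The hypothesis on `e₂` has `M - 1` in order to leave room here for the main term `1/(2s)`.
  have hrb : |r| ≤ M * i := by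
    rw [abs_le] at he₂ ⊢
    have b1 : (M - 1) * i ^ 2 ≤ (M - 1) * (i / 8) := by
      refine mul_le_mul_of_nonneg_left ?_ (by linarith)
      linarith [mul_le_mul_of_nonneg_right hi8 hsi.le]
    have b2 : 0 ≤ (M - 1) * i := mul_nonneg (by linarith) hsi.le
    constructor <;> linarith [he₂.1, he₂.2]
  have hrq : |r * q| ≤ M ^ 2 * i ^ 2 := by
    rw [abs_mul, show M ^ 2 * i ^ 2 = (M * i) * (M * i) by ring]
    exact mul_le_mul hrb hq (abs_nonneg _) (by positivity)
  have hRQ : |R - Q / 4| ≤ 2 * n := by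
    rw [abs_le] at hQn hRn ⊢
    constructor <;> linarith [hQn.1, hQn.2, hRn.1, hRn.2]
  have hPb : |P| ≤ 2 * n * i := by
    rw [hPR, abs_mul, abs_of_pos hsi]; gcongr
  have hαb : |α| ≤ 2 * M * σ := by
    have b1 : l * σ ≤ 0.48 * σ := by gcongr
    have b2 : 0 ≤ l * σ := mul_nonneg (by linarith) (by linarith)
    have b3 : σ ≤ M * σ := le_mul_of_one_le_left (by linarith) hM
    rw [abs_le] at he₁ ⊢
    constructor <;> linarith [he₁.1, he₁.2]
  have hi2M : (M - 1) * i ^ 2 ≤ M * i ^ 2 := by gcongr; linarith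
  set d₁ := 4 / 3 * e₁ + 2 / 3 * e₂ - r * q / 3 with hd₁
  have hd₁b : |d₁| ≤ 3 * M ^ 2 * i ^ 2 := by
    rw [abs_le] at he₁ he₂ hrq ⊢
    constructor <;> linarith [he₁.1, he₁.2, he₂.1, he₂.2, hrq.1, hrq.2]
  -- `X₁` and `X₂` collect the small linear and the quadratic terms; `κ` is the remaining coupling
  -- of `Q` into the equation for `R`. The three contributions of order `√s` to that coupling are
  -- `α/3`, `-α/6` and `-α/6`. They cancel because of the weight `1/4` in `R`, leaving `κ =
  -- O(s^(-1/2))`.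
  set X₁ := -(2 / 3 * e₁ + e₂ / 3 - 2 / 3 * (r * q)) * Q - 2 / 3 * (q * P) - 2 / 3 * (P * Q)
    + 1 / 3 * (r * (Q * Q)) with hX₁
  set X₂ := -(2 / 3) * (P * (R - Q / 4)) + 1 / 3 * (r * ((R - Q / 4) * Q)) with hX₂
  set κ := -(3 * i / 8) + i / 48 + i / 16 + d₁ / 4 - e₁ / 6 + s * e₂ * α / 3 + s * k / 3 with hκ
  have id₁ : -qIncrement r q α Q P = (i / 4 - l * σ) * Q + X₁ := by
    rw [hX₁, hα, hr]; unfold qIncrement; ring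
  have id₂ : P + s * -alphaIncrement r k q α Q P + -qIncrement r q α Q P / 4
      = (i / 4 - l * σ) * R + (-(l * σ) + 5 / 4 * i - d₁) * R + κ * Q + X₁ / 4 + X₂ := by
    rw [id₁, hκ, hX₂, hd₁]
    have : P + s * -alphaIncrement r k q α Q P = (R - Q / 4) * i
        - (4 / 3 * α + r / 3 * (2 - q) + 2 / 3 * P - r / 3 * Q) * (R - Q / 4)
        + ((-(1 / 2) + s * e₂) * α + s * k) / 3 * Q := by
      unfold alphaIncrement
      rw [hR, hr]
      linear_combination (-P - α * Q / 6) * hsi1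
    rw [this, hα, hr]
    ring
  have hmul : ∀ a b x y : ℝ, |a| ≤ x → |b| ≤ y → |a * b| ≤ x * y := fun a b x y ha hb => by
    rw [abs_mul]; exact mul_le_mul ha hb (abs_nonneg _) ((abs_nonneg _).trans ha)
  have hX₁b : |X₁| ≤ 3 * M ^ 2 * i ^ 2 * n + 2 * M * i * n ^ 2 := by
    have b1 : |-(2 / 3 * e₁ + e₂ / 3 - 2 / 3 * (r * q))| ≤ (5 / 3) * (M ^ 2 * i ^ 2) := by
      rw [abs_le] at he₁ he₂ hrq ⊢
      constructor <;> linarith [he₁.1, he₁.2, he₂.1, he₂.2, hrq.1, hrq.2]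
    have b2 := hmul _ _ _ _ b1 hQn
    have b3 := hmul _ _ _ _ hq hPb
    have b4 := hmul _ _ _ _ hPb hQn
    have b5 := hmul _ _ _ _ hrb (hmul _ _ _ _ hQn hQn)
    have b6 : M * i * (2 * n * i) ≤ 2 * (M ^ 2 * i ^ 2 * n) := by
      have := mul_le_mul_of_nonneg_right hMi22 hn
      linarith
    have b7 : i * n ^ 2 ≤ M * (i * n ^ 2) := le_mul_of_one_le_left (by positivity) hM
    rw [abs_le] at b2 b3 b4 b5 ⊢
    constructor <;> linarith [b2.1, b2.2, b3.1, b3.2, b4.1, b4.2, b5.1, b5.2]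
  have hX₂b : |X₂| ≤ 4 * M * i * n ^ 2 := by
    have b4 := hmul _ _ _ _ hPb hRQ
    have b5 := hmul _ _ _ _ hrb (hmul _ _ _ _ hRQ hQn)
    have b7 : i * n ^ 2 ≤ M * (i * n ^ 2) := le_mul_of_one_le_left (by positivity) hM
    rw [abs_le] at b4 b5 ⊢
    constructor <;> linarith [b4.1, b4.2, b5.1, b5.2]
  have hκb : |κ| ≤ 3 * M ^ 2 * σ * i := by
    have b1 : |s * e₂| ≤ M * i := by
      rw [abs_mul, abs_of_pos hs0]
      calc s * |e₂| ≤ s * (M * i ^ 2) := by gcongr; linarith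
        _ = M * i * (s * i) := by ring
        _ = M * i := by rw [hsi1, mul_one]
    have b2 : |s * k| ≤ M * i := by
      rw [abs_mul, abs_of_pos hs0]
      calc s * |k| ≤ s * (M * i ^ 2) := by gcongr
        _ = M * i * (s * i) := by ring
        _ = M * i := by rw [hsi1, mul_one]
    have b3 := hmul _ _ _ _ b1 hαb
    have b4 : M * i ≤ M ^ 2 * σ * i := by
      have : M * 1 ≤ M ^ 2 * σ := mul_le_mul hMM hσ (by norm_num) (by positivity)
      linarith [mul_le_mul_of_nonneg_right this hsi.le]
    have b5 : i ≤ M * i := le_mul_of_one_le_left hsi.le hM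
    rw [abs_le] at b2 b3 hd₁b he₁ ⊢
    constructor <;> linarith [b2.1, b2.2, b3.1, b3.2, hd₁b.1, hd₁b.2, he₁.1, he₁.2]
  rw [id₂, id₁]
  -- `R` is damped at twice the rate of `Q`. Half of the surplus is kept, and in `hcross` it absorbs
  -- `κ Q R` by Young's inequality at a cost of order `κ²/√s = O(s^(-3/2))`, which is integrable.
  have hR2 : (-(l * σ) + 5 / 4 * i - d₁) * R ^ 2 ≤ -(l * σ / 2) * R ^ 2 := by
    apply mul_le_mul_of_nonneg_right _ (sq_nonneg R)
    have : 0.47 * 1 ≤ l * σ := mul_le_mul hl hσ (by norm_num) (by linarith)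
    linarith [(abs_le.1 hd₁b).1]
  have hcross : κ * Q * R ≤ l * σ / 2 * R ^ 2 + 10 * M ^ 4 * i ^ 2 * σ * n ^ 2 := by
    have c1 : κ * Q * R ≤ 3 * M ^ 2 * σ * i * (n * |R|) := by
      calc κ * Q * R ≤ |κ * (Q * R)| := by rw [← mul_assoc]; exact le_abs_self _
        _ ≤ _ := by
          rw [abs_mul, abs_mul]
          exact mul_le_mul hκb (mul_le_mul_of_nonneg_right hQn (abs_nonneg _)) (by positivity)
            (by positivity)
    have c2 : 3 * M ^ 2 * i * (n * |R|) ≤ 0.47 / 2 * |R| ^ 2 + 10 * M ^ 4 * i ^ 2 * n ^ 2 := by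
      linarith [sq_nonneg (0.47 * |R| - 3 * (M ^ 2 * i * n)), sq_nonneg (M ^ 2 * i * n)]
    rw [sq_abs] at c2
    have c3 := mul_le_mul_of_nonneg_left c2 (show 0 ≤ σ by linarith)
    have c4 : 0.47 / 2 * (σ * R ^ 2) ≤ l / 2 * (σ * R ^ 2) := by gcongr
    linarith
  have hrest : Q * X₁ + R * (X₁ / 4 + X₂) ≤ 4 * M ^ 2 * i ^ 2 * n ^ 2 + 7 * M * i * n ^ 3 := by
    have c1 := (le_abs_self _).trans (hmul _ _ _ _ hQn hX₁b)
    have c2 := (le_abs_self _).trans (hmul _ _ _ _ hRn hX₁b)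
    have c3 := (le_abs_self _).trans (hmul _ _ _ _ hRn hX₂b)
    have c4 : 0 ≤ M ^ 2 * i ^ 2 * n ^ 2 := by positivity
    have c5 : 0 ≤ M * i * n ^ 3 := by positivity
    linarith
  have hM4 : 4 * M ^ 2 * i ^ 2 * n ^ 2 ≤ 4 * M ^ 4 * i ^ 2 * σ * n ^ 2 := by
    have : M ^ 2 * 1 ≤ M ^ 4 * σ :=
      mul_le_mul (pow_le_pow_right₀ hM (by norm_num)) hσ (by norm_num) (by positivity)
    have := mul_le_mul_of_nonneg_right this (show 0 ≤ i ^ 2 * n ^ 2 by positivity)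
    linarith
  have hψ : (i / 4 - l * σ) * Q ^ 2 + (i / 4 - l * σ) * R ^ 2 = (i / 4 - l * σ) * n ^ 2 := by
    rw [← hE]; ring
  linarith

/-- A nonnegative function with `E' ≤ (1 / (2 s) - 2 l √s + D / (s √s)) E` is
`O(√s exp (-(4 l / 3) s ^ (3 / 2)))`. -/
theorem exists_le_exp_of_deriv_le {E E' : ℝ → ℝ} {S l D : ℝ} (hS : 0 < S)
    (hE : ∀ s, S ≤ s → HasDerivAt E (E' s) s)
    (h : ∀ s, S ≤ s → E' s ≤ (1 / (2 * s) - 2 * l * √s + D / (s * √s)) * E s)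
    (h0 : ∀ s, S ≤ s → 0 ≤ E s) (hD : 0 ≤ D) :
    ∃ C, 0 ≤ C ∧ ∀ s, S ≤ s → E s ≤ C * (√s * Real.exp (-(4 / 3 * l * s ^ (3 / 2 : ℝ)))) := by
  -- `-G` is a primitive of the rate. The term `2D/√s` is nonnegative and is dropped from the lower
  -- bound for `exp G`; the logarithm produces the factor `√s`.
  set G : ℝ → ℝ := fun s => 4 / 3 * l * s ^ (3 / 2 : ℝ) + 2 * D * (√s)⁻¹ - Real.log s / 2 with hG
  have hGd : ∀ s, S ≤ s → HasDerivAt G (-(1 / (2 * s) - 2 * l * √s + D / (s * √s))) s := by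
    intro s hs
    have hs0 : 0 < s := by linarith
    have hσ : 0 < √s := Real.sqrt_pos.2 hs0
    refine ((((hasDerivAt_rpow_three_halves hs0).const_mul (4 / 3 * l)).add
      (((Real.hasDerivAt_sqrt hs0.ne').inv hσ.ne').const_mul (2 * D))).sub
      ((Real.hasDerivAt_log hs0.ne').div_const 2)).congr_deriv ?_
    rw [Real.sq_sqrt hs0.le]
    field_simp
    ring
  have hanti := antitoneOn_Ici_of_hasDerivAt_nonpos (f := fun s => E s * Real.exp (G s))
    (fun s hs => (hE s hs).mul (hGd s hs).exp) (fun s hs => by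
      have := mul_le_mul_of_nonneg_right (h s hs) (Real.exp_pos (G s)).le
      linarith)
  refine ⟨E S * Real.exp (G S), mul_nonneg (h0 S le_rfl) (Real.exp_pos _).le, fun s hs => ?_⟩
  have hs0 : 0 < s := by linarith
  have h1 := hanti (Set.self_mem_Ici) hs hs
  have h2 : Real.exp (Real.log s / 2) = √s := by
    rw [Real.sqrt_eq_rpow, Real.rpow_def_of_pos hs0]; ring_nf
  have h3 : 1 / (√s * Real.exp (-(4 / 3 * l * s ^ (3 / 2 : ℝ)))) ≤ Real.exp (G s) := by
    rw [← h2, ← Real.exp_add, one_div, ← Real.exp_neg]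
    refine Real.exp_le_exp.2 ?_
    simp only [hG]
    have : 0 ≤ 2 * D * (√s)⁻¹ := by positivity
    linarith
  have hpos : 0 < √s * Real.exp (-(4 / 3 * l * s ^ (3 / 2 : ℝ))) :=
    mul_pos (Real.sqrt_pos.2 hs0) (Real.exp_pos _)
  have h4 := (mul_le_mul_of_nonneg_left h3 (h0 s hs)).trans h1
  rwa [mul_one_div, div_le_iff₀ hpos] at h4

/-- Small solutions of the increment system far to the left stay small and decay like
`s ^ (1 / 4) exp (-(2 √2 / 9) s ^ (3 / 2))`. -/
theorem increment_decay {α q r k Q P Q' P' : ℝ → ℝ} {S M : ℝ} (hM : 1 ≤ M)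
    (hS : 100 * M ^ 4 ≤ S)
    (hα : ∀ s, S ≤ s → |α s - (√2 / 2 * √s - 1 / (8 * s))| ≤ M / s ^ 2)
    (hr : ∀ s, S ≤ s → |r s + 1 / (2 * s)| ≤ (M - 1) / s ^ 2)
    (hq : ∀ s, S ≤ s → |q s| ≤ M / s) (hk : ∀ s, S ≤ s → |k s| ≤ M / s ^ 2)
    (hQ : ∀ s, S ≤ s → HasDerivAt Q (Q' s) s) (hP : ∀ s, S ≤ s → HasDerivAt P (P' s) s)
    (hQ' : ∀ s, S ≤ s → |Q s| ≤ 1 → |P s| ≤ 1 →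
      Q' s = -qIncrement (r s) (q s) (α s) (Q s) (P s))
    (hP' : ∀ s, S ≤ s → |Q s| ≤ 1 → |P s| ≤ 1 →
      P' s = -alphaIncrement (r s) (k s) (q s) (α s) (Q s) (P s))
    (hinit : Q S ^ 2 + (S * P S + Q S / 4) ^ 2 ≤ 1) :
    (∀ s, S ≤ s → |Q s| ≤ 1 ∧ |P s| ≤ 1) ∧ ∃ C, ∀ s, S ≤ s →
      |Q s| ≤ C * (s ^ (1 / 4 : ℝ) * Real.exp (-(2 * √2 / 9) * s ^ (3 / 2 : ℝ))) ∧
      |P s| ≤ C * (s ^ (-(3 / 4) : ℝ) * Real.exp (-(2 * √2 / 9) * s ^ (3 / 2 : ℝ))) := by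
  have hM4 : 1 ≤ M ^ 4 := one_le_pow₀ hM
  have hM24 : M ^ 2 ≤ M ^ 4 := pow_le_pow_right₀ hM (by norm_num)
  have hM14 : M ≤ M ^ 4 := le_self_pow₀ hM (by norm_num)
  have hS100 : 100 ≤ S := by linarith
  set l : ℝ := √2 / 3 with hl
  have hsq2 : √2 ^ 2 = 2 := Real.sq_sqrt (by norm_num)
  have hs2 : 1.41 ≤ √2 := Real.le_sqrt_of_sq_le (by norm_num)
  have hs2' : √2 ≤ 1.44 := Real.sqrt_le_iff.2 ⟨by norm_num, by norm_num⟩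
  have hl1 : 0.47 ≤ l := by rw [hl]; linarith
  have hl2 : l ≤ 0.48 := by rw [hl]; linarith
  set R : ℝ → ℝ := fun s => s * P s + Q s / 4 with hR
  set E : ℝ → ℝ := fun s => Q s ^ 2 + R s ^ 2 with hE
  have hE0 : ∀ s, 0 ≤ E s := fun s => by positivity
  have hEd : ∀ s, S ≤ s → HasDerivAt E
      (2 * (Q s * Q' s + R s * (P s + s * P' s + Q' s / 4))) s := by
    intro s hs
    refine (((hQ s hs).pow 2).add
      ((((hasDerivAt_id s).mul (hP s hs)).add ((hQ s hs).div_const 4)).pow 2)).congr_deriv ?_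
    simp [hR]
    ring
  have hsmall : ∀ s, S ≤ s → E s ≤ 1 → |Q s| ≤ 1 ∧ |P s| ≤ 1 := by
    intro s hs h1
    have hs0 : 0 < s := by linarith
    have hQ1 : |Q s| ≤ 1 := abs_le_one_iff_mul_self_le_one.2 (by nlinarith [sq_nonneg (R s)])
    have hR1 : |R s| ≤ 1 := abs_le_one_iff_mul_self_le_one.2 (by nlinarith [sq_nonneg (Q s)])
    refine ⟨hQ1, ?_⟩
    have h2 : |s * P s| ≤ 2 := by
      simp only [hR] at hR1
      rw [abs_le] at hR1 hQ1 ⊢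
      constructor <;> linarith [hR1.1, hR1.2, hQ1.1, hQ1.2]
    rw [abs_mul, abs_of_pos hs0] at h2
    nlinarith [abs_nonneg (P s)]
  have hest : ∀ s, S ≤ s → E s ≤ 1 →
      2 * (Q s * Q' s + R s * (P s + s * P' s + Q' s / 4)) ≤
        (1 / (2 * s) - 2 * l * √s + 28 * M ^ 4 / (s * √s) + 14 * M / s * √(E s)) * E s := by
    intro s hs h1
    obtain ⟨hQ1, hP1⟩ := hsmall s hs h1
    have hs0 : 0 < s := by linarith
    have h2 := energy_estimate (s := s) (l := l) (e₁ := α s - (√2 / 2 * √s - 1 / (8 * s)))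
      (e₂ := r s + 1 / (2 * s)) (q := q s) (k := k s) (M := M) (Q := Q s) (P := P s) (R := R s)
      (n := √(E s)) hl1 hl2 hM (by linarith) (hα s hs) (hr s hs) (hq s hs) (hk s hs) rfl
      (Real.sqrt_nonneg _) (Real.sq_sqrt (hE0 s)).symm
    rw [show -(1 / (2 * s)) + (r s + 1 / (2 * s)) = r s by ring,
      show 3 / 2 * l * √s - 1 / (8 * s) + (α s - (√2 / 2 * √s - 1 / (8 * s))) = α s by
        rw [hl]; ring, ← hQ' s hs hQ1 hP1, ← hP' s hs hQ1 hP1, Real.sq_sqrt (hE0 s)] at h2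
    calc _ ≤ 2 * ((1 / (4 * s) - l * √s + 14 * M ^ 4 / (s * √s) + 7 * M / s * √(E s)) * E s) := by
          linarith
      _ = _ := by
        have hσ : √s ≠ 0 := (Real.sqrt_pos.2 hs0).ne'
        field_simp
        ring
  have hcrude : ∀ s, S ≤ s → E s ≤ 1 →
      2 * (Q s * Q' s + R s * (P s + s * P' s + Q' s / 4)) ≤ -2 * E s := by
    intro s hs h1
    refine (hest s hs h1).trans (mul_le_mul_of_nonneg_right ?_ (hE0 s))
    have hs0 : 0 < s := by linarith
    have hσ : 10 ≤ √s := Real.le_sqrt_of_sq_le (by linarith)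
    have hn : √(E s) ≤ 1 := Real.sqrt_le_one.2 h1
    have b1 : 1 / (2 * s) ≤ 1 := by rw [div_le_one (by positivity)]; linarith
    have b2 : 28 * M ^ 4 / (s * √s) ≤ 1 := by rw [div_le_one (by positivity)]; nlinarith
    have b3 : 14 * M / s * √(E s) ≤ 1 := by
      refine mul_le_one₀ ?_ (Real.sqrt_nonneg _) hn
      rw [div_le_one (by positivity)]; linarith
    nlinarith
  -- Barrier argument: the equations are assumed only while `|Q|, |P| ≤ 1`, and `E` is strictly
  -- decreasing wherever it equals `1`.
  have hE1 : ∀ s, S ≤ s → E s ≤ 1 :=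
    le_of_hasDerivAt_neg_of_eq hEd hinit fun s hs h1 => by
      have := hcrude s hs h1.le
      rw [h1] at this
      linarith
  refine ⟨fun s hs => hsmall s hs (hE1 s hs), ?_⟩
  -- This bootstrap gives `√E = O(s^(-1/2))`, so the nonlinear error `O(√E/s)` becomes `O(s^(-3/2))`
  -- and joins the constant `D`.
  have hanti := antitoneOn_Ici_of_hasDerivAt_nonpos (f := fun s => E s * s)
    (fun s hs => (hEd s hs).mul (hasDerivAt_id s)) (fun s hs => by
      have h1 := hcrude s hs (hE1 s hs)
      have h2 := hE0 s
      have h3 := mul_le_mul_of_nonneg_right h1 (show 0 ≤ s by linarith)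
      nlinarith)
  obtain ⟨C, hC, hEC⟩ := exists_le_exp_of_deriv_le (l := l) (D := 28 * M ^ 4 + 14 * M * √(E S * S))
    (by linarith) hEd (fun s hs => by
      refine (hest s hs (hE1 s hs)).trans (mul_le_mul_of_nonneg_right ?_ (hE0 s))
      have hs0 : 0 < s := by linarith
      have hσ : 0 < √s := Real.sqrt_pos.2 hs0
      have h1 : √(E s) * √s ≤ √(E S * S) := by
        rw [← Real.sqrt_mul (hE0 s)]
        exact Real.sqrt_le_sqrt (hanti Set.self_mem_Ici hs hs)
      have h2 : 14 * M / s * √(E s) ≤ 14 * M * √(E S * S) / (s * √s) := by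
        rw [div_mul_eq_mul_div, div_le_div_iff₀ hs0 (by positivity)]
        have := mul_le_mul_of_nonneg_left h1 (show 0 ≤ 14 * M * s by positivity)
        linarith
      rw [add_div]
      linarith) (fun s _ => hE0 s) (by positivity)
  have hsqrt : ∀ s, S ≤ s → √(E s) ≤
      √C * (s ^ (1 / 4 : ℝ) * Real.exp (-(2 * √2 / 9) * s ^ (3 / 2 : ℝ))) := by
    intro s hs
    have hs0 : 0 < s := by linarith
    refine (Real.sqrt_le_sqrt (hEC s hs)).trans_eq ?_
    rw [Real.sqrt_mul hC]
    congr 1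
    refine (Real.sqrt_eq_iff_mul_self_eq (by positivity) (by positivity)).2 ?_
    rw [mul_mul_mul_comm, ← Real.rpow_add hs0, ← Real.exp_add, Real.sqrt_eq_rpow, hl]
    congr 2
    · norm_num
    · ring
  refine ⟨2 * √C, fun s hs => ?_⟩
  have hs0 : 0 < s := by linarith
  have h1 := hsqrt s hs
  have hQn : |Q s| ≤ √(E s) := Real.abs_le_sqrt (by simp only [hE]; nlinarith [sq_nonneg (R s)])
  have hRn : |R s| ≤ √(E s) := Real.abs_le_sqrt (by simp only [hE]; nlinarith [sq_nonneg (Q s)])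
  have hn := Real.sqrt_nonneg (E s)
  refine ⟨by linarith, ?_⟩
  have h2 : |s * P s| ≤ 2 * √(E s) := by
    simp only [hR] at hRn
    rw [abs_le] at hRn hQn ⊢
    constructor <;> linarith [hRn.1, hRn.2, hQn.1, hQn.2]
  rw [abs_mul, abs_of_pos hs0] at h2
  have h3 : s ^ (1 / 4 : ℝ) = s * s ^ (-(3 / 4) : ℝ) := by
    rw [← Real.rpow_one_add' hs0.le (by norm_num)]; norm_num
  rw [h3] at h1
  refine le_of_mul_le_mul_left ?_ hs0
  calc s * |P s| ≤ 2 * √(E s) := h2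
    _ ≤ _ := by linarith

/-! ### Using and transferring the asymptotic expansions. -/

theorem hasExpansionAtBot_of_sub_isBigO_exp {f g : ℝ → ℝ} {ρ p κ : ℝ} {c : ℕ → ℝ} (hκ : 0 < κ)
    (hf : HasExpansionAtBot f ρ c)
    (h : (fun t => g t - f t) =O[atBot] fun t : ℝ =>
      (-t) ^ p * Real.exp (-κ * (-t) ^ (3 / 2 : ℝ))) : HasExpansionAtBot g ρ c := by
  intro N
  have h1 : (fun t : ℝ => (-t) ^ p * Real.exp (-κ * (-t) ^ (3 / 2 : ℝ))) =O[atBot]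
      fun t : ℝ => (-t) ^ (ρ - 3 * (N : ℝ) / 2) := by
    have h2 := ((isBigO_refl (fun s : ℝ => s ^ p) atTop).mul
      (isLittleO_exp_neg_mul_rpow_three_halves hκ (ρ - 3 * (N : ℝ) / 2 - p)).isBigO).comp_tendsto
        tendsto_neg_atBot_atTop
    refine h2.trans_eventuallyEq ?_
    filter_upwards [eventually_lt_atBot 0] with t ht
    simp only [Function.comp]
    rw [← Real.rpow_add (by linarith)]
    congr 1; ring
  refine ((hf N).add (h.trans h1)).congr_left fun t => ?_
  ring

/-- Of the expansions, only `q = O(s^(-3/2))` and the two leading terms of `α` enter the decay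
estimate. The coefficient `-1/8` matters because it contributes to the power `s^(1/4)`. -/
theorem exists_farfield {u q α : ℝ → ℝ} {a b : ℕ → ℝ} (hu : IsHastingsMcLeod u)
    (h : HasQAlphaAsymptotics a b q α) :
    ∃ M S : ℝ, 1 ≤ M ∧ ∀ s, S ≤ s →
      |α (-s) - (√2 / 2 * √s - 1 / (8 * s))| ≤ M / s ^ 2 ∧
      |deriv u (-s) / u (-s) + 1 / (2 * s)| ≤ (M - 1) / s ^ 2 ∧
      |q (-s)| ≤ M / s ∧ |u (-s) ^ 2 + -s / 2| ≤ M / s ^ 2 := by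
  obtain ⟨S₀, C₀, hS₀, H⟩ := hu.exists_asymptotics
  obtain ⟨C₁, h₁⟩ := ((h.expansion_q 0).comp_tendsto tendsto_neg_atTop_atBot).bound
  obtain ⟨C₂, h₂⟩ := ((h.expansion_α 2).comp_tendsto tendsto_neg_atTop_atBot).bound
  obtain ⟨S, hS⟩ := eventually_atTop.1 (h₁.and h₂)
  have hpow : ∀ s x y C : ℝ, 1 ≤ s → x ≤ y → C * ‖s ^ x‖ ≤ |C| * s ^ y := by
    intro s x y C hs hxy
    rw [Real.norm_of_nonneg (by positivity)]
    exact mul_le_mul (le_abs_self C) (Real.rpow_le_rpow_of_exponent_le hs hxy) (by positivity)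
      (abs_nonneg C)
  refine ⟨|C₀| + |C₁| + |C₂| + 1, max S (max S₀ 1), by
    linarith [abs_nonneg C₀, abs_nonneg C₁, abs_nonneg C₂], fun s hs => ?_⟩
  have hs1 : 1 ≤ s := (le_max_right _ _).trans ((le_max_right _ _).trans hs)
  have hs0 : 0 < s := by linarith
  obtain ⟨-, hr, hk, -⟩ := H s ((le_max_left _ _).trans ((le_max_right _ _).trans hs))
  obtain ⟨hq, hα⟩ := hS s ((le_max_left _ _).trans hs)
  have a0 := abs_nonneg C₀
  have a1 := abs_nonneg C₁
  have a2 := abs_nonneg C₂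
  have a3 := le_abs_self C₀
  refine ⟨?_, ?_, ?_, ?_⟩
  · have h3 := hα.trans (hpow s _ (-2) C₂ hs1 (by norm_num) |> (by simpa using ·))
    have e : √2 / 2 = 1 / √2 := by
      rw [div_eq_div_iff (by norm_num) (by positivity)]; norm_num
    simp only [Function.comp, Finset.sum_range_succ, Finset.sum_range_zero, h.b_zero, h.b_one,
      neg_neg, Real.norm_eq_abs] at h3
    norm_num at h3
    have e3 : s ^ (-1 : ℝ) = 1 / s := by rw [Real.rpow_neg_one, one_div]
    rw [Real.sqrt_eq_rpow s, e]
    rw [e3] at h3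
    calc _ = |α (-s) - ((√2)⁻¹ * s ^ (1 / 2 : ℝ) + -(1 / 8 * (1 / s)))| := by
          congr 1; field_simp; ring
      _ ≤ |C₂| / s ^ 2 := h3
      _ ≤ _ := by gcongr; linarith
  · refine hr.trans ?_
    gcongr; linarith
  · have h3 := hq.trans (hpow s _ (-1) C₁ hs1 (by norm_num) |> (by simpa using ·))
    simp only [Function.comp, Finset.sum_range_zero, sub_zero, Real.norm_eq_abs,
      Real.rpow_neg_one] at h3
    refine h3.trans ?_
    rw [← div_eq_mul_inv]
    gcongr; linarith
  · rw [show u (-s) ^ 2 + -s / 2 = u (-s) ^ 2 - s / 2 by ring]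
    refine hk.trans ?_
    gcongr; linarith

/-! ### Existence and uniqueness for bounded Lipschitz fields. -/

theorem exists_solution_Icc {E : Type*} [NormedAddCommGroup E] [NormedSpace ℝ E] [CompleteSpace E]
    {f : ℝ → E → E} {T t₀ t₁ : ℝ} {K L : NNReal} (ht₁ : t₁ ∈ Set.Icc T t₀)
    (hcont : ∀ x, ContinuousOn (fun t => f t x) (Set.Icc T t₀))
    (hK : ∀ t ∈ Set.Icc T t₀, LipschitzWith K (f t))
    (hL : ∀ t ∈ Set.Icc T t₀, ∀ x, ‖f t x‖ ≤ L) (z₁ : E) :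
    ∃ z : ℝ → E, z t₁ = z₁ ∧
      ∀ t ∈ Set.Icc T t₀, HasDerivWithinAt z (f t (z t)) (Set.Icc T t₀) t := by
  have hm : 0 ≤ max (t₀ - t₁) (t₁ - T) := le_max_of_le_left (by linarith [ht₁.2])
  have hPL : IsPicardLindelof f (⟨t₁, ht₁⟩ : Set.Icc T t₀) z₁
      (L * (max (t₀ - t₁) (t₁ - T)).toNNReal) 0 L K :=
    { lipschitzOnWith := fun t ht => (hK t ht).lipschitzOnWith
      continuousOn := fun x _ => hcont x
      norm_le := fun t ht x _ => hL t ht x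
      mul_max_le := by rw [NNReal.coe_mul, Real.coe_toNNReal _ hm, NNReal.coe_zero, sub_zero] }
  exact hPL.exists_eq_forall_mem_Icc_hasDerivWithinAt (by simp)

theorem eqOn_Icc_of_lipschitz {E : Type*} [NormedAddCommGroup E] [NormedSpace ℝ E]
    {f : ℝ → E → E} {T t₀ t₁ : ℝ} {K : NNReal} (ht₁ : t₁ ∈ Set.Icc T t₀)
    (hK : ∀ t ∈ Set.Icc T t₀, LipschitzWith K (f t)) {z w : ℝ → E} (h : z t₁ = w t₁)
    (hz : ∀ t ∈ Set.Icc T t₀, HasDerivWithinAt z (f t (z t)) (Set.Icc T t₀) t)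
    (hw : ∀ t ∈ Set.Icc T t₀, HasDerivWithinAt w (f t (w t)) (Set.Icc T t₀) t) :
    Set.EqOn z w (Set.Icc T t₀) := by
  have hright : Set.Icc t₁ t₀ ⊆ Set.Icc T t₀ := Set.Icc_subset_Icc_left ht₁.1
  have hleft : Set.Icc T t₁ ⊆ Set.Icc T t₀ := Set.Icc_subset_Icc_right ht₁.2
  have dr : ∀ v : ℝ → E, (∀ t ∈ Set.Icc T t₀, HasDerivWithinAt v (f t (v t)) (Set.Icc T t₀) t) →
      ∀ t ∈ Set.Ico t₁ t₀, HasDerivWithinAt v (f t (v t)) (Set.Ici t) t := fun v hv t ht =>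
    (hv t ⟨ht₁.1.trans ht.1, ht.2.le⟩).mono_of_mem_nhdsWithin
      (mem_of_superset (Icc_mem_nhdsGE ht.2) (Set.Icc_subset_Icc_left (ht₁.1.trans ht.1)))
  have dl : ∀ v : ℝ → E, (∀ t ∈ Set.Icc T t₀, HasDerivWithinAt v (f t (v t)) (Set.Icc T t₀) t) →
      ∀ t ∈ Set.Ioc T t₁, HasDerivWithinAt v (f t (v t)) (Set.Iic t) t := fun v hv t ht =>
    (hv t ⟨ht.1.le, ht.2.trans ht₁.2⟩).mono_of_mem_nhdsWithin
      (mem_of_superset (Icc_mem_nhdsLE ht.1) (Set.Icc_subset_Icc_right (ht.2.trans ht₁.2)))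
  intro t ht
  rcases le_total t₁ t with h1 | h1
  · exact ODE_solution_unique_of_mem_Icc_right (v := f) (s := fun _ => Set.univ) (K := K)
      (fun t ht => (hK t (hright ⟨ht.1, ht.2.le⟩)).lipschitzOnWith)
      (fun t ht => (hz t (hright ht)).continuousWithinAt.mono hright) (dr z hz)
      (fun _ _ => Set.mem_univ _)
      (fun t ht => (hw t (hright ht)).continuousWithinAt.mono hright) (dr w hw)
      (fun _ _ => Set.mem_univ _) h ⟨h1, ht.2⟩
  · exact ODE_solution_unique_of_mem_Icc_left (v := f) (s := fun _ => Set.univ) (K := K)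
      (fun t ht => (hK t (hleft ⟨ht.1.le, ht.2⟩)).lipschitzOnWith)
      (fun t ht => (hz t (hleft ht)).continuousWithinAt.mono hleft) (dl z hz)
      (fun _ _ => Set.mem_univ _)
      (fun t ht => (hw t (hleft ht)).continuousWithinAt.mono hleft) (dl w hw)
      (fun _ _ => Set.mem_univ _) h ⟨ht.1, h1⟩

/-- A vector field that is bounded and Lipschitz, uniformly on compact time intervals, has
solutions on the whole half-line. -/
theorem exists_solution_Iic {E : Type*} [NormedAddCommGroup E] [NormedSpace ℝ E] [CompleteSpace E]
    {f : ℝ → E → E} {t₀ t₁ : ℝ} (ht₁ : t₁ ≤ t₀)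
    (hcont : ∀ x, ContinuousOn (fun t => f t x) (Set.Iic t₀))
    (hb : ∀ T, ∃ K L : NNReal, ∀ t ∈ Set.Icc T t₀, LipschitzWith K (f t) ∧ ∀ x, ‖f t x‖ ≤ L)
    (z₁ : E) :
    ∃ z : ℝ → E, z t₁ = z₁ ∧
      ∀ t ∈ Set.Iic t₀, HasDerivWithinAt z (f t (z t)) (Set.Iic t₀) t := by
  have hmem : ∀ n : ℕ, t₁ ∈ Set.Icc (t₁ - n) t₀ := fun n => ⟨by simp, ht₁⟩
  have hex : ∀ n : ℕ, ∃ z : ℝ → E, z t₁ = z₁ ∧ ∀ t ∈ Set.Icc (t₁ - n) t₀,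
      HasDerivWithinAt z (f t (z t)) (Set.Icc (t₁ - n) t₀) t := fun n => by
    obtain ⟨K, L, h⟩ := hb (t₁ - n)
    exact exists_solution_Icc (hmem n) (fun x => (hcont x).mono Set.Icc_subset_Iic_self)
      (fun t ht => (h t ht).1) (fun t ht => (h t ht).2) z₁
  choose z hz1 hz using hex
  have hagree : ∀ m n : ℕ, m ≤ n → Set.EqOn (z m) (z n) (Set.Icc (t₁ - m) t₀) := by
    intro m n hmn
    obtain ⟨K, L, h⟩ := hb (t₁ - m)
    have hsub : Set.Icc (t₁ - m) t₀ ⊆ Set.Icc (t₁ - n) t₀ :=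
      Set.Icc_subset_Icc_left (by have : (m : ℝ) ≤ n := by exact_mod_cast hmn
                                  linarith)
    exact eqOn_Icc_of_lipschitz (hmem m) (fun t ht => (h t ht).1) ((hz1 m).trans (hz1 n).symm)
      (hz m) fun t ht => (hz n t (hsub ht)).mono hsub
  -- The natural ceiling is `0` for `t ≥ t₁`, where `z 0` is already defined up to `t₀`.
  set w : ℝ → E := fun t => z ⌈t₁ - t⌉₊ t with hw
  have hwz : ∀ n : ℕ, Set.EqOn w (z n) (Set.Icc (t₁ - n) t₀) := by
    intro n t ht
    have h1 : ⌈t₁ - t⌉₊ ≤ n := Nat.ceil_le.2 (by linarith [ht.1])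
    exact hagree _ n h1 ⟨by linarith [Nat.le_ceil (t₁ - t)], ht.2⟩
  refine ⟨w, (hwz 0 (hmem 0)).trans (hz1 0), fun t ht => ?_⟩
  obtain ⟨n, hn⟩ := exists_nat_gt (t₁ - t)
  have htn : t ∈ Set.Icc (t₁ - n) t₀ := ⟨by linarith, ht⟩
  have hnhds : Set.Icc (t₁ - n) t₀ ∈ 𝓝[Set.Iic t₀] t := by
    rw [← Set.Ici_inter_Iic, Set.inter_comm]
    exact inter_mem_nhdsWithin _ (Ici_mem_nhds (by linarith))
  have h1 := ((hz n t htn).congr (hwz n) (hwz n htn)).mono_of_mem_nhdsWithin hnhds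
  rwa [← hwz n htn] at h1

/-! ### Uniqueness for the `q₂`-`α` system. -/

theorem IsQAlphaSolutionOn.mono {u q α : ℝ → ℝ} {S T : Set ℝ} (h : IsQAlphaSolutionOn u q α S)
    (hTS : T ⊆ S) : IsQAlphaSolutionOn u q α T :=
  ⟨fun t ht => (h.deriv_q t (hTS ht)).mono hTS, fun t ht => (h.deriv_α t (hTS ht)).mono hTS⟩

theorem abs_energy_deriv_le {Q P F G C : ℝ} (hF : |F| ≤ C * √(Q ^ 2 + P ^ 2))
    (hG : |G| ≤ C * √(Q ^ 2 + P ^ 2)) :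
    |2 * Q * F + 2 * P * G| ≤ 4 * C * (Q ^ 2 + P ^ 2) := by
  have hE : 0 ≤ Q ^ 2 + P ^ 2 := by positivity
  have hQ : |Q| ≤ √(Q ^ 2 + P ^ 2) := Real.abs_le_sqrt (by nlinarith [sq_nonneg P])
  have hP : |P| ≤ √(Q ^ 2 + P ^ 2) := Real.abs_le_sqrt (by nlinarith [sq_nonneg Q])
  have h1 : |Q * F| ≤ √(Q ^ 2 + P ^ 2) * (C * √(Q ^ 2 + P ^ 2)) := by
    rw [abs_mul]; exact mul_le_mul hQ hF (abs_nonneg _) (Real.sqrt_nonneg _)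
  have h2 : |P * G| ≤ √(Q ^ 2 + P ^ 2) * (C * √(Q ^ 2 + P ^ 2)) := by
    rw [abs_mul]; exact mul_le_mul hP hG (abs_nonneg _) (Real.sqrt_nonneg _)
  have h3 : √(Q ^ 2 + P ^ 2) * (C * √(Q ^ 2 + P ^ 2)) = C * (Q ^ 2 + P ^ 2) := by
    rw [mul_left_comm, Real.mul_self_sqrt hE]
  rw [h3] at h1 h2
  rw [abs_le] at h1 h2 ⊢
  constructor <;> linarith [h1.1, h1.2, h2.1, h2.2]

theorem hasDerivWithinAt_energy {Q P : ℝ → ℝ} {F G t : ℝ} {S : Set ℝ}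
    (hQ : HasDerivWithinAt Q F S t) (hP : HasDerivWithinAt P G S t) :
    HasDerivWithinAt (fun t => Q t ^ 2 + P t ^ 2) (2 * Q t * F + 2 * P t * G) S t :=
  ((hQ.pow 2).add (hP.pow 2)).congr_deriv (by simp)

theorem IsHastingsMcLeod.continuous_sq_add {u : ℝ → ℝ} (hu : IsHastingsMcLeod u) :
    Continuous fun t => u t ^ 2 + t / 2 := by
  have := hu.differentiable.continuous
  fun_prop

theorem exists_abs_le_of_continuousOn {f : ℝ → ℝ} {s : Set ℝ} (hs : IsCompact s)
    (hf : ContinuousOn f s) : ∃ M, 0 ≤ M ∧ ∀ t ∈ s, |f t| ≤ M := by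
  obtain ⟨M, hM⟩ := hs.exists_bound_of_continuousOn hf
  exact ⟨max M 0, le_max_right _ _, fun t ht => (hM t ht).trans (le_max_left _ _)⟩

theorem IsQAlphaSolutionOn.hasDerivWithinAt_sub {u q α p β : ℝ → ℝ} {S : Set ℝ} {t : ℝ}
    (h : IsQAlphaSolutionOn u q α S) (h' : IsQAlphaSolutionOn u p β S) (ht : t ∈ S) :
    HasDerivWithinAt (fun t => p t - q t)
      (qIncrement (deriv u t / u t) (q t) (α t) (p t - q t) (β t - α t)) S t ∧
    HasDerivWithinAt (fun t => β t - α t)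
      (alphaIncrement (deriv u t / u t) (u t ^ 2 + t / 2) (q t) (α t) (p t - q t) (β t - α t))
      S t := by
  refine ⟨((h'.deriv_q t ht).sub (h.deriv_q t ht)).congr_deriv ?_,
    ((h'.deriv_α t ht).sub (h.deriv_α t ht)).congr_deriv ?_⟩
  · unfold qIncrement; ring
  · unfold alphaIncrement; ring

/-- On the compact interval between `t₁` and `t` both solutions are bounded, so the increments are
controlled linearly by the difference itself. Gronwall for the sum of squares then starts from zero.
-/
theorem IsQAlphaSolutionOn.eqOn {u q α p β : ℝ → ℝ} {J : Set ℝ} {t₁ : ℝ}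
    (hu : IsHastingsMcLeod u) (hJ : J.OrdConnected) (ht₁ : t₁ ∈ J)
    (h : IsQAlphaSolutionOn u q α J) (h' : IsQAlphaSolutionOn u p β J)
    (hq : p t₁ = q t₁) (hα : β t₁ = α t₁) : Set.EqOn p q J ∧ Set.EqOn β α J := by
  have key : ∀ t ∈ J, p t = q t ∧ β t = α t := by
    intro t ht
    have hsub : Set.uIcc t₁ t ⊆ J := hJ.uIcc_subset ht₁ ht
    have g := h.mono hsub
    have g' := h'.mono hsub
    have cq : ContinuousOn q (Set.uIcc t₁ t) := fun x hx => (g.deriv_q x hx).continuousWithinAt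
    have cα : ContinuousOn α (Set.uIcc t₁ t) := fun x hx => (g.deriv_α x hx).continuousWithinAt
    have cp : ContinuousOn p (Set.uIcc t₁ t) := fun x hx => (g'.deriv_q x hx).continuousWithinAt
    have cβ : ContinuousOn β (Set.uIcc t₁ t) := fun x hx => (g'.deriv_α x hx).continuousWithinAt
    obtain ⟨M₁, n₁, b₁⟩ := exists_abs_le_of_continuousOn isCompact_uIcc
      (hu.continuous_deriv_div.continuousOn (s := Set.uIcc t₁ t))
    obtain ⟨M₂, n₂, b₂⟩ := exists_abs_le_of_continuousOn isCompact_uIcc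
      (hu.continuous_sq_add.continuousOn (s := Set.uIcc t₁ t))
    obtain ⟨M₃, n₃, b₃⟩ := exists_abs_le_of_continuousOn isCompact_uIcc cq
    obtain ⟨M₄, n₄, b₄⟩ := exists_abs_le_of_continuousOn isCompact_uIcc cα
    obtain ⟨M₅, n₅, b₅⟩ := exists_abs_le_of_continuousOn isCompact_uIcc (cp.sub cq)
    obtain ⟨M₆, n₆, b₆⟩ := exists_abs_le_of_continuousOn isCompact_uIcc (cβ.sub cα)
    set M := M₁ + M₂ + M₃ + M₄ + M₅ + M₆
    have hE := le_mul_exp_of_abs_deriv_le (a := t₁) (b := t) (M := 4 * (3 * (M + 1) ^ 2))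
      (fun x hx => hasDerivWithinAt_energy (g.hasDerivWithinAt_sub g' hx).1
        (g.hasDerivWithinAt_sub g' hx).2) (fun x hx => by
        have c₁ := (b₁ x hx).trans (show M₁ ≤ M by linarith)
        have c₂ := (b₂ x hx).trans (show M₂ ≤ M by linarith)
        have c₃ := (b₃ x hx).trans (show M₃ ≤ M by linarith)
        have c₄ := (b₄ x hx).trans (show M₄ ≤ M by linarith)
        have c₅ := (b₅ x hx).trans (show M₅ ≤ M by linarith)
        have c₆ := (b₆ x hx).trans (show M₆ ≤ M by linarith)
        have d₁ : |p x - q x| ≤ √((p x - q x) ^ 2 + (β x - α x) ^ 2) :=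
          Real.abs_le_sqrt (by nlinarith [sq_nonneg (β x - α x)])
        have d₂ : |β x - α x| ≤ √((p x - q x) ^ 2 + (β x - α x) ^ 2) :=
          Real.abs_le_sqrt (by nlinarith [sq_nonneg (p x - q x)])
        exact abs_energy_deriv_le (abs_qIncrement_le c₁ c₃ c₄ c₅ c₆ d₁ d₂)
          (abs_alphaIncrement_le c₁ c₂ c₃ c₄ c₅ c₆ d₁ d₂))
    simp only [hq, hα, sub_self] at hE
    norm_num at hE
    constructor
    · have : (p t - q t) ^ 2 = 0 := by nlinarith [sq_nonneg (p t - q t), sq_nonneg (β t - α t)]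
      linarith [pow_eq_zero_iff (two_ne_zero) |>.1 this]
    · have : (β t - α t) ^ 2 = 0 := by nlinarith [sq_nonneg (p t - q t), sq_nonneg (β t - α t)]
      linarith [pow_eq_zero_iff (two_ne_zero) |>.1 this]
  exact ⟨fun t ht => (key t ht).1, fun t ht => (key t ht).2⟩

/-! ### The truncated increment field. -/

/-- Truncation to `[-1, 1]`. -/
noncomputable def clip (x : ℝ) : ℝ := max (-1) (min x 1)

theorem abs_clip_le_one (x : ℝ) : |clip x| ≤ 1 :=
  abs_le.2 ⟨le_max_left _ _, max_le (by norm_num) (min_le_right _ _)⟩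

theorem clip_of_abs_le_one {x : ℝ} (h : |x| ≤ 1) : clip x = x := by
  rw [abs_le] at h
  rw [clip, min_eq_left h.2, max_eq_right h.1]

theorem abs_clip_sub_clip_le (x y : ℝ) : |clip x - clip y| ≤ |x - y| := by
  unfold clip
  have h1 := abs_max_sub_max_le_max (-1) (min x 1) (-1) (min y 1)
  have h2 := abs_min_sub_min_le_max x 1 y 1
  rw [sub_self, abs_zero, max_eq_right (abs_nonneg (min x 1 - min y 1))] at h1
  rw [sub_self, abs_zero, max_eq_left (abs_nonneg (x - y))] at h2
  exact h1.trans h2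

theorem abs_clip_le_abs (x : ℝ) : |clip x| ≤ |x| := by
  simpa [clip] using abs_clip_sub_clip_le x 0

/-- The increment vector field with arguments truncated to `[-1, 1]`. -/
noncomputable def clippedField (r k q α : ℝ) (z : ℝ × ℝ) : ℝ × ℝ :=
  (qIncrement r q α (clip z.1) (clip z.2), alphaIncrement r k q α (clip z.1) (clip z.2))

theorem abs_clippedField_le {r k q α M d : ℝ} {z : ℝ × ℝ} (hM : 1 ≤ M) (hr : |r| ≤ M)
    (hk : |k| ≤ M) (hq : |q| ≤ M) (hα : |α| ≤ M) (h1 : |clip z.1| ≤ d) (h2 : |clip z.2| ≤ d) :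
    |(clippedField r k q α z).1| ≤ 3 * (M + 1) ^ 2 * d ∧
      |(clippedField r k q α z).2| ≤ 3 * (M + 1) ^ 2 * d :=
  ⟨abs_qIncrement_le hr hq hα ((abs_clip_le_one _).trans hM) ((abs_clip_le_one _).trans hM) h1 h2,
    abs_alphaIncrement_le hr hk hq hα ((abs_clip_le_one _).trans hM)
      ((abs_clip_le_one _).trans hM) h1 h2⟩

theorem norm_clippedField_le {r k q α M : ℝ} (z : ℝ × ℝ) (hM : 1 ≤ M) (hr : |r| ≤ M)
    (hk : |k| ≤ M) (hq : |q| ≤ M) (hα : |α| ≤ M) :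
    ‖clippedField r k q α z‖ ≤ 3 * (M + 1) ^ 2 := by
  have h := abs_clippedField_le hM hr hk hq hα (abs_clip_le_one z.1) (abs_clip_le_one z.2)
  rw [mul_one] at h
  exact max_le h.1 h.2

theorem lipschitzWith_clippedField {r k q α M : ℝ} (hM : 1 ≤ M) (hr : |r| ≤ M)
    (hk : |k| ≤ M) (hq : |q| ≤ M) (hα : |α| ≤ M) :
    LipschitzWith (3 * (M + 1 + 1) ^ 2).toNNReal (clippedField r k q α) := by
  refine LipschitzWith.of_dist_le_mul fun z w => ?_
  rw [Real.coe_toNNReal _ (by positivity), dist_eq_norm, dist_eq_norm]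
  have hadd : ∀ {x y : ℝ}, |x| ≤ M → |y| ≤ 1 → |x + y| ≤ M + 1 := fun hx hy =>
    (abs_add_le _ _).trans (add_le_add hx hy)
  have hsub : ∀ x y : ℝ, |clip x - clip y| ≤ M + 1 := fun x y => by
    have h1 := abs_le.1 (abs_clip_le_one x)
    have h2 := abs_le.1 (abs_clip_le_one y)
    rw [abs_le]; constructor <;> linarith [h1.1, h1.2, h2.1, h2.2]
  have d1 : |clip z.1 - clip w.1| ≤ ‖z - w‖ :=
    (abs_clip_sub_clip_le _ _).trans (norm_fst_le (z - w))
  have d2 : |clip z.2 - clip w.2| ≤ ‖z - w‖ :=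
    (abs_clip_sub_clip_le _ _).trans (norm_snd_le (z - w))
  refine max_le ?_ ?_
  · change |qIncrement _ _ _ _ _ - qIncrement _ _ _ _ _| ≤ _
    rw [qIncrement_sub]
    exact abs_qIncrement_le (by linarith) (hadd hq (abs_clip_le_one _))
      (hadd hα (abs_clip_le_one _)) (hsub _ _) (hsub _ _) d1 d2
  · change |alphaIncrement _ _ _ _ _ _ - alphaIncrement _ _ _ _ _ _| ≤ _
    rw [alphaIncrement_sub]
    exact abs_alphaIncrement_le (by linarith) (by linarith) (hadd hq (abs_clip_le_one _))
      (hadd hα (abs_clip_le_one _)) (hsub _ _) (hsub _ _) d1 d2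

/-! ### The stability theorem. -/

theorem mainTheorem3 (u : ℝ → ℝ) (hu : IsHastingsMcLeod u)
    (t₀ : ℝ) (q₀ α₀ : ℝ → ℝ) (hsol : IsQAlphaSolutionOn u q₀ α₀ (Set.Iic t₀))
    (a b : ℕ → ℝ) (hasym : HasQAlphaAsymptotics a b q₀ α₀)
    (t₁ : ℝ) (ht₁ : t₁ ≤ t₀) :
    ∃ δ : ℝ, 0 < δ ∧ ∀ x y : ℝ, |x - q₀ t₁| < δ → |y - α₀ t₁| < δ →
      ∃ q α : ℝ → ℝ, q t₁ = x ∧ α t₁ = y ∧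
        IsQAlphaSolutionOn u q α (Set.Iic t₀) ∧
        HasQAlphaAsymptotics a b q α ∧
        ((fun t : ℝ => q t - q₀ t) =O[atBot] fun t : ℝ =>
          (-t) ^ (1 / 4 : ℝ) * Real.exp (-(2 * √2 / 9) * (-t) ^ (3 / 2 : ℝ))) ∧
        ((fun t : ℝ => α t - α₀ t) =O[atBot] fun t : ℝ =>
          (-t) ^ (-(3 / 4) : ℝ) * Real.exp (-(2 * √2 / 9) * (-t) ^ (3 / 2 : ℝ))) ∧
        ∀ (J : Set ℝ) (p β : ℝ → ℝ), J.OrdConnected → t₁ ∈ J → J ⊆ Set.Iic t₀ →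
          IsQAlphaSolutionOn u p β J → p t₁ = x → β t₁ = y →
          Set.EqOn p q J ∧ Set.EqOn β α J := by
  obtain ⟨M, S₀, hM, hfar⟩ := exists_farfield hu hasym
  -- The time `-S` separates the compact part from the far field. Besides the far-field thresholds
  -- it ensures `-S ≤ t₁`, and the `+ 1` places `-s` in the interior of the half-line for `s ≥ S`,
  -- so derivatives there are two-sided.
  set S : ℝ := max (max S₀ (100 * M ^ 4)) (max (-t₁) (-t₀ + 1)) with hS
  have hS₀ : S₀ ≤ S := (le_max_left _ _).trans (le_max_left _ _)
  have hSM : 100 * M ^ 4 ≤ S := (le_max_right _ _).trans (le_max_left _ _)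
  have hSt₁ : -t₁ ≤ S := (le_max_left _ _).trans (le_max_right _ _)
  have hSt₀ : -t₀ + 1 ≤ S := (le_max_right _ _).trans (le_max_right _ _)
  have hS1 : 1 ≤ S := by linarith [one_le_pow₀ (n := 4) hM]
  clear_value S
  set r : ℝ → ℝ := fun t => deriv u t / u t with hr
  set k : ℝ → ℝ := fun t => u t ^ 2 + t / 2 with hk
  have cr : Continuous r := hu.continuous_deriv_div
  have ck : Continuous k := hu.continuous_sq_add
  have cq : ContinuousOn q₀ (Set.Iic t₀) := fun t ht => (hsol.deriv_q t ht).continuousWithinAt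
  have cα : ContinuousOn α₀ (Set.Iic t₀) := fun t ht => (hsol.deriv_α t ht).continuousWithinAt
  have hbdd : ∀ T, ∃ N, 1 ≤ N ∧ ∀ t ∈ Set.Icc T t₀,
      |r t| ≤ N ∧ |k t| ≤ N ∧ |q₀ t| ≤ N ∧ |α₀ t| ≤ N := by
    intro T
    obtain ⟨M₁, n₁, b₁⟩ := exists_abs_le_of_continuousOn isCompact_Icc
      (cr.continuousOn (s := Set.Icc T t₀))
    obtain ⟨M₂, n₂, b₂⟩ := exists_abs_le_of_continuousOn isCompact_Icc
      (ck.continuousOn (s := Set.Icc T t₀))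
    obtain ⟨M₃, n₃, b₃⟩ := exists_abs_le_of_continuousOn isCompact_Icc
      (cq.mono (Set.Icc_subset_Iic_self (a := T)))
    obtain ⟨M₄, n₄, b₄⟩ := exists_abs_le_of_continuousOn isCompact_Icc
      (cα.mono (Set.Icc_subset_Iic_self (a := T)))
    refine ⟨M₁ + M₂ + M₃ + M₄ + 1, by linarith, fun t ht => ⟨?_, ?_, ?_, ?_⟩⟩
    · linarith [b₁ t ht]
    · linarith [b₂ t ht]
    · linarith [b₃ t ht]
    · linarith [b₄ t ht]
  obtain ⟨N, hN, hNb⟩ := hbdd (-S)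
  set L : ℝ := 4 * (3 * (N + 1) ^ 2) with hL
  -- The exponential is the Gronwall loss on `[-S, t₀]`, and `2 + 2S²` bounds the energy `Q² + (SP +
  -- Q/4)²` by `Q² + P²`. With `δ = 1/(W + 1) ≤ 1` squares of the initial errors are at most `δ`,
  -- and `W δ ≤ 1`.
  set W : ℝ := (2 + 2 * S ^ 2) * (2 * Real.exp (L * (t₀ + S))) with hW
  have hW0 : 0 < W := by positivity
  refine ⟨1 / (W + 1), by positivity, fun x y hx hy => ?_⟩
  set f : ℝ → ℝ × ℝ → ℝ × ℝ := fun t => clippedField (r t) (k t) (q₀ t) (α₀ t) with hf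
  obtain ⟨z, hz1, hz⟩ := exists_solution_Iic (f := f) ht₁ (fun w => by
      have := cr.continuousOn (s := Set.Iic t₀)
      have := ck.continuousOn (s := Set.Iic t₀)
      simp only [hf, clippedField, qIncrement, alphaIncrement]
      fun_prop)
    (fun T => by
      obtain ⟨N, hN, hNb⟩ := hbdd T
      refine ⟨(3 * (N + 1 + 1) ^ 2).toNNReal, (3 * (N + 1) ^ 2).toNNReal, fun t ht => ?_⟩
      obtain ⟨h1, h2, h3, h4⟩ := hNb t ht
      refine ⟨lipschitzWith_clippedField hN h1 h2 h3 h4, fun w => ?_⟩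
      rw [Real.coe_toNNReal _ (by positivity)]
      exact norm_clippedField_le w hN h1 h2 h3 h4)
    (x - q₀ t₁, y - α₀ t₁)
  set Q : ℝ → ℝ := fun t => (z t).1 with hQ
  set P : ℝ → ℝ := fun t => (z t).2 with hP
  have hQd : ∀ t ∈ Set.Iic t₀, HasDerivWithinAt Q
      (qIncrement (r t) (q₀ t) (α₀ t) (clip (Q t)) (clip (P t))) (Set.Iic t₀) t := fun t ht =>
    (hasFDerivAt_fst (𝕜 := ℝ) (p := z t)).comp_hasDerivWithinAt t (hz t ht)
  have hPd : ∀ t ∈ Set.Iic t₀, HasDerivWithinAt P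
      (alphaIncrement (r t) (k t) (q₀ t) (α₀ t) (clip (Q t)) (clip (P t))) (Set.Iic t₀) t :=
    fun t ht => (hasFDerivAt_snd (𝕜 := ℝ) (p := z t)).comp_hasDerivWithinAt t (hz t ht)
  have hQ1 : Q t₁ = x - q₀ t₁ := by simp only [hQ, hz1]
  have hP1 : P t₁ = y - α₀ t₁ := by simp only [hP, hz1]
  have hnear : ∀ t ∈ Set.Icc (-S) t₀, (2 + 2 * S ^ 2) * (Q t ^ 2 + P t ^ 2) ≤ 1 := by
    intro t ht
    have hsub : Set.uIcc t₁ t ⊆ Set.Icc (-S) t₀ :=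
      Set.OrdConnected.uIcc_subset Set.ordConnected_Icc ⟨by linarith, ht₁⟩ ht
    have hsub' : Set.uIcc t₁ t ⊆ Set.Iic t₀ := hsub.trans Set.Icc_subset_Iic_self
    have hE := le_mul_exp_of_abs_deriv_le (a := t₁) (b := t) (M := L)
      (fun x hx => hasDerivWithinAt_energy ((hQd x (hsub' hx)).mono hsub')
        ((hPd x (hsub' hx)).mono hsub')) (fun x hx => by
        obtain ⟨h1, h2, h3, h4⟩ := hNb x (hsub hx)
        have d₁ : |clip (Q x)| ≤ √(Q x ^ 2 + P x ^ 2) :=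
          (abs_clip_le_abs _).trans (Real.abs_le_sqrt (by nlinarith [sq_nonneg (P x)]))
        have d₂ : |clip (P x)| ≤ √(Q x ^ 2 + P x ^ 2) :=
          (abs_clip_le_abs _).trans (Real.abs_le_sqrt (by nlinarith [sq_nonneg (Q x)]))
        have h := abs_clippedField_le (z := z x) hN h1 h2 h3 h4 d₁ d₂
        exact abs_energy_deriv_le h.1 h.2)
    have hδ1 : 1 / (W + 1) ≤ 1 := by rw [div_le_one (by positivity)]; linarith
    have hδ0 : 0 < 1 / (W + 1) := by positivity
    have hWδ : W * (1 / (W + 1)) ≤ 1 := by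
      rw [mul_one_div, div_le_one (by positivity)]; linarith
    have hsq : ∀ v : ℝ, |v| < 1 / (W + 1) → v ^ 2 ≤ 1 / (W + 1) := fun v hv => by
      rw [← sq_abs]; nlinarith [abs_nonneg v]
    have hin : Q t₁ ^ 2 + P t₁ ^ 2 ≤ 2 * (1 / (W + 1)) := by
      rw [hQ1, hP1]; linarith [hsq _ hx, hsq _ hy]
    have hexp : Real.exp (L * |t - t₁|) ≤ Real.exp (L * (t₀ + S)) := by
      refine Real.exp_le_exp.2 (mul_le_mul_of_nonneg_left ?_ (by positivity))
      rw [abs_le]; constructor <;> linarith [ht.1, ht.2]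
    calc _ ≤ (2 + 2 * S ^ 2) * (2 * (1 / (W + 1)) * Real.exp (L * (t₀ + S))) := by
          refine mul_le_mul_of_nonneg_left (hE.trans ?_) (by positivity)
          exact mul_le_mul hin hexp (Real.exp_pos _).le (by positivity)
      _ = W * (1 / (W + 1)) := by rw [hW]; ring
      _ ≤ 1 := hWδ
  have hHas : ∀ s, S ≤ s → -s ∈ Set.Iic t₀ ∧ Set.Iic t₀ ∈ 𝓝 (-s) := fun s hs =>
    ⟨by simp only [Set.mem_Iic]; linarith, Iic_mem_nhds (by linarith)⟩
  obtain ⟨hfar1, C, hC⟩ := increment_decay (α := fun s => α₀ (-s)) (q := fun s => q₀ (-s))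
    (r := fun s => r (-s)) (k := fun s => k (-s)) (Q := fun s => Q (-s)) (P := fun s => P (-s))
    (Q' := fun s => -qIncrement (r (-s)) (q₀ (-s)) (α₀ (-s)) (clip (Q (-s))) (clip (P (-s))))
    (P' := fun s =>
      -alphaIncrement (r (-s)) (k (-s)) (q₀ (-s)) (α₀ (-s)) (clip (Q (-s))) (clip (P (-s))))
    (S := S) hM hSM
    (fun s hs => (hfar s (hS₀.trans hs)).1) (fun s hs => (hfar s (hS₀.trans hs)).2.1)
    (fun s hs => (hfar s (hS₀.trans hs)).2.2.1) (fun s hs => (hfar s (hS₀.trans hs)).2.2.2)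
    (fun s hs => by
      obtain ⟨h1, h2⟩ := hHas s hs
      exact (((hQd _ h1).hasDerivAt h2).scomp s (hasDerivAt_neg s)).congr_deriv (by simp))
    (fun s hs => by
      obtain ⟨h1, h2⟩ := hHas s hs
      exact (((hPd _ h1).hasDerivAt h2).scomp s (hasDerivAt_neg s)).congr_deriv (by simp))
    (fun s hs h1 h2 => by rw [clip_of_abs_le_one h1, clip_of_abs_le_one h2])
    (fun s hs h1 h2 => by rw [clip_of_abs_le_one h1, clip_of_abs_le_one h2])
    (by
      have h := hnear (-S) ⟨le_rfl, by linarith⟩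
      nlinarith [sq_nonneg (S * P (-S) - Q (-S) / 4), sq_nonneg (Q (-S)), sq_nonneg (P (-S)),
        mul_nonneg (sq_nonneg S) (sq_nonneg (Q (-S)))])
  -- The truncation is thus inactive everywhere, and `(q₀ + Q, α₀ + P)` solves the original system.
  have hsmall : ∀ t ∈ Set.Iic t₀, |Q t| ≤ 1 ∧ |P t| ≤ 1 := by
    intro t ht
    rcases le_total t (-S) with h | h
    · simpa using hfar1 (-t) (by linarith)
    · have h1 := hnear t ⟨h, ht⟩
      have h2 : Q t ^ 2 + P t ^ 2 ≤ 1 := by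
        nlinarith [mul_nonneg (sq_nonneg S) (add_nonneg (sq_nonneg (Q t)) (sq_nonneg (P t))),
          sq_nonneg (Q t), sq_nonneg (P t)]
      exact ⟨abs_le_one_iff_mul_self_le_one.2 (by nlinarith [sq_nonneg (P t)]),
        abs_le_one_iff_mul_self_le_one.2 (by nlinarith [sq_nonneg (Q t)])⟩
  have hnewsol : IsQAlphaSolutionOn u (fun t => q₀ t + Q t) (fun t => α₀ t + P t) (Set.Iic t₀) := by
    refine ⟨fun t ht => ?_, fun t ht => ?_⟩
    · obtain ⟨h1, h2⟩ := hsmall t ht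
      have h := (hsol.deriv_q t ht).add (hQd t ht)
      rw [clip_of_abs_le_one h1, clip_of_abs_le_one h2] at h
      exact h.congr_deriv (qIncrement_eq _ _ _ _ _).symm
    · obtain ⟨h1, h2⟩ := hsmall t ht
      have h := (hsol.deriv_α t ht).add (hPd t ht)
      rw [clip_of_abs_le_one h1, clip_of_abs_le_one h2] at h
      exact h.congr_deriv (alphaIncrement_eq _ _ _ _ _ _ _).symm
  have hOq : (fun t : ℝ => (q₀ t + Q t) - q₀ t) =O[atBot] fun t : ℝ =>
      (-t) ^ (1 / 4 : ℝ) * Real.exp (-(2 * √2 / 9) * (-t) ^ (3 / 2 : ℝ)) := by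
    refine IsBigO.of_bound C ?_
    filter_upwards [eventually_le_atBot (-S)] with t ht
    have h := (hC (-t) (by linarith)).1
    have ht0 : 0 ≤ -t := by linarith
    rw [neg_neg] at h
    rw [add_sub_cancel_left, Real.norm_eq_abs, Real.norm_of_nonneg (by positivity)]
    exact h
  have hOα : (fun t : ℝ => (α₀ t + P t) - α₀ t) =O[atBot] fun t : ℝ =>
      (-t) ^ (-(3 / 4) : ℝ) * Real.exp (-(2 * √2 / 9) * (-t) ^ (3 / 2 : ℝ)) := by
    refine IsBigO.of_bound C ?_
    filter_upwards [eventually_le_atBot (-S)] with t ht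
    have h := (hC (-t) (by linarith)).2
    have ht0 : 0 ≤ -t := by linarith
    rw [neg_neg] at h
    rw [add_sub_cancel_left, Real.norm_eq_abs, Real.norm_of_nonneg (by positivity)]
    exact h
  refine ⟨fun t => q₀ t + Q t, fun t => α₀ t + P t, by simp only [hQ1]; ring,
    by simp only [hP1]; ring, hnewsol, ?_, hOq, hOα, ?_⟩
  · exact { hasym with
      expansion_q := hasExpansionAtBot_of_sub_isBigO_exp (by positivity) hasym.expansion_q hOq
      expansion_α := hasExpansionAtBot_of_sub_isBigO_exp (by positivity) hasym.expansion_α hOα }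
  · intro J p β hJ ht₁J hJt₀ hpβ hp hβ
    exact (hnewsol.mono hJt₀).eqOn hu hJ ht₁J hpβ (by simp only [hQ1, hp]; ring)
      (by simp only [hP1, hβ]; ring)
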